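/- **Setting.** Let $f,\theta_1,\dots,\theta_s\in\mathbb R[\mathbf y]$, $\mathbf y=(y_1,\dots,y_\ell)$, let $G(\mathbf x)$ be a $q\times q$ symmetric polynomial matrix in $\mathbf x=(x_1,\dots,x_n)$ and let $P(\mathbf y,\mathbf x)=\sum_{\beta}P_\beta(\mathbf x)\mathbf y^\beta$ be an $m\times m$ symmetric polynomial matrix in $(\mathbf y,\mathbf x)$. Put $\Theta=\{\theta_1,\dots,\theta_s\}$, $$\mathcal Y=\{\mathbf y\in\mathbb R^\ell\mid\theta_i(\mathbf y)\ge0,\ i=1,\dots,s\},\qquad \mathcal X=\{\mathbf x\in\mathbb R^n\mid G(\mathbf x)\succeq0\},$$ $$f^\star=\inf\{f(\mathbf y)\mid \mathbf y\in\mathcal Y,\ P(\mathbf y,\mathbf x)\succeq0\ \ \forall\mathbf x\in\mathcal X\},$$ and assume that this infimum is attained. A polynomial matrix $F$ is *SOS* if $F=T^{\intercal}T$ for a polynomial matrix $T$ with finitely many rows. A polynomial $h$ is *SOS-convex* if its Hessian is an SOS matrix, and a symmetric polynomial matrix $Q(\mathbf y)$ is *PSD-SOS-convex* if $\mathbf v^{\intercal}Q(\mathbf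 y)\mathbf v$ is SOS-convex for every $\mathbf v\in\mathbb R^m$. **Cones.** The degree of a polynomial matrix is the largest total degree of its entries. For $A$ of size $mq\times mq$ and $B$ of size $q\times q$ let $(A,B)_m$ be the $m\times m$ matrix of the traces of the $q\times q$ blocks of $A^{\intercal}(I_m\otimes B)$. For $k\in\mathbb N$ let $$\mathcal Q^m_k(G)=\{\Sigma_0+(\Sigma_1,G)_m\mid \Sigma_0,\Sigma_1 \text{ SOS matrices of sizes } m \text{ and } mq,\ \deg\Sigma_0\le 2k,\ \deg(\Sigma_1,G)_m\le2k\}.$$ With $d_G=\lceil\deg(G)/2\rceil$ and $k\ge d_G$, let $\mathcal M^m_k(G)$ be the set of sequences $\mathbf S=(S_\alpha)_{|\alpha|\le2k}$ of symmetric $m\times m$ real matrices such that the block matrices $[S_{\alpha+\beta}]_{|\alpha|,|\beta|\le k}$ and $[\sum_\gamma S_{\alpha+\beta+\gamma}\otimes G_\gamma]_{|\alpha|,|\beta|\le k-d_G}$ are positive semidefinite, where $G=\sum_\gamma G_\gamma\mathbf x^\gamma$. Write $\mathcal Q_k(\Theta)$, $\mathcal M_k(\Theta)$ for these sets (in the variables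 $\mathbf y$) with $m=1$ and the matrix $\operatorname{diag}(\theta_1,\dots,\theta_s)$. For $F(\mathbf x)=\sum_\alpha F_\alpha\mathbf x^\alpha$ let $\mathscr L_{\mathbf S}(F)=\sum_\alpha\operatorname{tr}(F_\alpha S_\alpha)$; for $h(\mathbf y)=\sum_\beta h_\beta\mathbf y^\beta$ and a real sequence $\mathbf s$ let $\mathscr H_{\mathbf s}(h)=\sum_\beta h_\beta s_\beta$. For a finitely atomic positive semidefinite matrix-valued measure $\Phi=\sum_{i=1}^rW_i\delta_{\mathbf x^{(i)}}$ (distinct $\mathbf x^{(i)}\in\mathcal X$, $W_i\succeq0$) let $\mathscr L_\Phi(F)=\int_{\mathcal X}\operatorname{tr}(F\,\mathrm d\Phi)$. Set $\mathscr L(P(\mathbf y,\mathbf x))=\sum_\beta\mathscr L(P_\beta)\mathbf y^\beta$ and $\mathscr H_{\mathbf s}(P(\mathbf y,\mathbf x))=\sum_\beta s_\beta P_\beta(\mathbf x)$. **Hierarchy.** Let $k_{\mathbf y}=\max\{\deg f,\deg\theta_i,\deg_{\mathbf y}P_{ij}\}$ and $k_{\mathbf x}=\max\{\deg_{\mathbf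 x}P_{ij},\deg G\}$. For $k\ge\lceil k_{\mathbf x}/2\rceil$ define, in $[-\infty,+\infty]$, $$f_k^{\mathrm{primal}}=\sup\{\rho\mid f-\rho-\mathscr L_{\mathbf S}(P(\mathbf y,\mathbf x))\in\mathcal Q_{\lceil k_{\mathbf y}/2\rceil}(\Theta),\ \rho\in\mathbb R,\ \mathbf S\in\mathcal M^m_k(G)\},$$ $$f_k^{\mathrm{dual}}=\inf\{\mathscr H_{\mathbf s}(f)\mid \mathbf s\in\mathcal M_{\lceil k_{\mathbf y}/2\rceil}(\Theta),\ \mathscr H_{\mathbf s}(1)=1,\ \mathscr H_{\mathbf s}(P(\mathbf y,\mathbf x))\in\mathcal Q^m_k(G)\}.$$ **Proposition.** Assume that 1. $f,-\theta_1,\dots,-\theta_s$ are SOS-convex, $-P(\mathbf y,\mathbf x)$ is PSD-SOS-convex in $\mathbf y$ for every $\mathbf x\in\mathcal X$, and $\mathcal X$ is compact; 2. (Slater condition) there is $\bar{\mathbf y}\in\mathcal Y$ with $\theta_i(\bar{\mathbf y})>0$ for all $i$ and $P(\bar{\mathbf y},\mathbf x)\succ0$ for all $\mathbf x\in\mathcal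 X$. Then the sequences $(f_k^{\mathrm{primal}})_{k\ge\lceil k_{\mathbf x}/2\rceil}$ and $(f_k^{\mathrm{dual}})_{k\ge\lceil k_{\mathbf x}/2\rceil}$ are monotonically non-increasing, and $f^\star\le f_k^{\mathrm{primal}}$ and $f^\star\le f_k^{\mathrm{dual}}$ for all $k\ge\lceil k_{\mathbf x}/2\rceil$. Moreover, there is a finitely atomic positive semidefinite matrix-valued measure $\Phi^\star$ on $\mathcal X$ such that $$f-f^\star-\mathscr L_{\Phi^\star}(P(\mathbf y,\mathbf x))\in\mathcal Q_{\lceil k_{\mathbf y}/2\rceil}(\Theta).$$ -/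

import Mathlib

open MvPolynomial Matrix
open scoped Kronecker

noncomputable section

namespace RobustPMI

/-! ### Polynomial matrices -/

section PolynomialMatrices

variable {σ R : Type*} [CommSemiring R] {ι κ : Type*} [Fintype ι] [Fintype κ]

/-- The degree of a polynomial matrix: the largest total degree of an entry. -/
def matDeg (F : Matrix ι κ (MvPolynomial σ R)) : ℕ :=
  Finset.univ.sup fun i => Finset.univ.sup fun j => (F i j).totalDegree

/-- The coefficient matrix `F_α` of the monomial `x ^ α` in `F`. -/
def coeffMat (F : Matrix ι κ (MvPolynomial σ R)) (α : σ →₀ ℕ) : Matrix ι κ R :=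
  F.map (coeff α)

open Classical in
/-- The set of exponents of the monomials that appear in some entry of `F`. -/
def matSupport (F : Matrix ι κ (MvPolynomial σ R)) : Finset (σ →₀ ℕ) :=
  Finset.univ.biUnion fun i => Finset.univ.biUnion fun j => (F i j).support

/-- The value `F(x)` of a polynomial matrix at a point. -/
def evalMat (x : σ → R) (F : Matrix ι κ (MvPolynomial σ R)) : Matrix ι κ R :=
  F.map (eval x)

end PolynomialMatrices

/-- `⌈d / 2⌉` for a natural number `d`. -/
def halfCeil (d : ℕ) : ℕ := (d + 1) / 2

/-- `F` is an SOS matrix: `F = Tᵀ T` for a polynomial matrix `T` with finitely many rows. -/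
def IsSOSMatrix {σ ι : Type*} (F : Matrix ι ι (MvPolynomial σ ℝ)) : Prop :=
  ∃ (l : ℕ) (T : Matrix (Fin l) ι (MvPolynomial σ ℝ)), F = Tᵀ * T

/-- The Hessian matrix of a polynomial. -/
def hessian {σ : Type*} (h : MvPolynomial σ ℝ) : Matrix σ σ (MvPolynomial σ ℝ) :=
  Matrix.of fun i j => pderiv i (pderiv j h)

/-- A polynomial is SOS-convex if its Hessian is an SOS matrix. -/
def SOSConvex {σ : Type*} (h : MvPolynomial σ ℝ) : Prop := IsSOSMatrix (hessian h)

/-- A polynomial matrix `Q` is PSD-SOS-convex if, for every real vector `v`, the Hessian of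
`vᵀ Q v` has the form `F_vᵀ F_v`. -/
def PSDSOSConvex {σ ι : Type*} [Fintype ι] (Q : Matrix ι ι (MvPolynomial σ ℝ)) : Prop :=
  ∀ v : ι → ℝ, SOSConvex ((fun i => C (v i)) ⬝ᵥ (Q *ᵥ fun i => C (v i)))

/-! ### Truncated matrix quadratic modules and cones of truncated matrix moments -/

/-- The bilinear map `(A, B)_m = Tr_m (Aᵀ (I_m ⊗ B))`, where `Tr_m` takes the trace of each of the
`m × m` blocks, each block being of size `q × q`. -/
def blockPairing {ι κ R : Type*} [Fintype ι] [DecidableEq ι] [Fintype κ] [CommSemiring R]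
    (A : Matrix (ι × κ) (ι × κ) R) (B : Matrix κ κ R) : Matrix ι ι R :=
  Matrix.of fun i j => ∑ a, (Aᵀ * ((1 : Matrix ι ι R) ⊗ₖ B)) (i, a) (j, a)

section Cones

variable {σ ι κ : Type*} [Fintype ι] [DecidableEq ι] [Fintype κ]

/-- The `k`-th truncated matrix quadratic module `Q_k^m(G)`. -/
def quadModule (ι : Type*) [Fintype ι] [DecidableEq ι] (k : ℕ)
    (G : Matrix κ κ (MvPolynomial σ ℝ)) : Set (Matrix ι ι (MvPolynomial σ ℝ)) :=
  {F | ∃ (S₀ : Matrix ι ι (MvPolynomial σ ℝ)) (S₁ : Matrix (ι × κ) (ι × κ) (MvPolynomial σ ℝ)),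
    IsSOSMatrix S₀ ∧ IsSOSMatrix S₁ ∧
    matDeg S₀ ≤ 2 * k ∧ matDeg (blockPairing S₁ G) ≤ 2 * k ∧
    F = S₀ + blockPairing S₁ G}

/-- The `d`-th order moment matrix: its `(α, β)` block is `S_{α+β}`, for `|α|, |β| ≤ d`. -/
def momentMatrix (d : ℕ) (S : (σ →₀ ℕ) → Matrix ι ι ℝ) :
    Matrix ({α : σ →₀ ℕ // α.degree ≤ d} × ι) ({α : σ →₀ ℕ // α.degree ≤ d} × ι) ℝ :=
  Matrix.of fun a b => S (a.1 + b.1) a.2 b.2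

/-- The `d`-th order localizing matrix: its `(α, β)` block is
`∑_{γ ∈ supp G} S_{α+β+γ} ⊗ G_γ`, for `|α|, |β| ≤ d`. -/
def localizingMatrix (d : ℕ) (G : Matrix κ κ (MvPolynomial σ ℝ)) (S : (σ →₀ ℕ) → Matrix ι ι ℝ) :
    Matrix ({α : σ →₀ ℕ // α.degree ≤ d} × (ι × κ))
      ({α : σ →₀ ℕ // α.degree ≤ d} × (ι × κ)) ℝ :=
  Matrix.of fun a b =>
    (∑ γ ∈ matSupport G, S (a.1 + b.1 + γ) ⊗ₖ coeffMat G γ) a.2 b.2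

/-- The cone `M_k^m(G)` of truncated sequences `(S_α)_{|α| ≤ 2k}` of symmetric matrices with
`M_k(S) ⪰ 0` and `M_{k-d_G}(G S) ⪰ 0`, where `d_G = ⌈deg G / 2⌉`; meant for `k ≥ d_G`.
A truncated sequence is written as a sequence indexed by all exponents that is zero beyond
degree `2k`; the two matrices only involve the entries of degree at most `2k`. -/
def momentCone (ι : Type*) [Fintype ι] [DecidableEq ι] (k : ℕ)
    (G : Matrix κ κ (MvPolynomial σ ℝ)) : Set ((σ →₀ ℕ) → Matrix ι ι ℝ) :=
  {S | (∀ α, (S α).IsSymm) ∧ (∀ α, 2 * k < α.degree → S α = 0) ∧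
    (momentMatrix k S).PosSemidef ∧
    (localizingMatrix (k - halfCeil (matDeg G)) G S).PosSemidef}

/-- The scalar case `Q_k(H)` for a finite list `H` of polynomials: the case `m = 1` for the
diagonal matrix with the members of `H` on the diagonal. -/
def scalarQuadModule {s : ℕ} (k : ℕ) (H : Fin s → MvPolynomial σ ℝ) : Set (MvPolynomial σ ℝ) :=
  {p | (Matrix.of fun _ _ => p) ∈ quadModule (Fin 1) k (Matrix.diagonal H)}

/-- The scalar case `M_k(H)` for a finite list `H` of polynomials. -/
def scalarMomentCone {s : ℕ} (k : ℕ) (H : Fin s → MvPolynomial σ ℝ) : Set ((σ →₀ ℕ) → ℝ) :=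
  {t | (fun α => Matrix.of fun _ _ => t α) ∈ momentCone (Fin 1) k (Matrix.diagonal H)}

/-- The Riesz functional `F ↦ ∑_{α ∈ supp F} tr (F_α S_α)` of a matrix sequence. -/
def riesz (S : (σ →₀ ℕ) → Matrix ι ι ℝ) (F : Matrix ι ι (MvPolynomial σ ℝ)) : ℝ :=
  ∑ α ∈ matSupport F, (coeffMat F α * S α).trace

/-- The functional `h ↦ ∑_{α ∈ supp h} h_α s_α` of a scalar sequence. -/
def scalarRiesz (t : (σ →₀ ℕ) → ℝ) (h : MvPolynomial σ ℝ) : ℝ :=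
  ∑ α ∈ h.support, coeff α h * t α

end Cones

/-! ### Matrix-valued measures -/

section MatrixMeasures

variable {n : ℕ} {X : Set (Fin n → ℝ)} {ι : Type*} [Fintype ι]

/-- A PSD symmetric matrix-valued measure on `X`, given by its entries, which are finite signed
Borel measures on `X`. -/
def IsPSDMatrixMeasure (Φ : Matrix ι ι (MeasureTheory.SignedMeasure X)) : Prop :=
  Φ.IsSymm ∧ ∀ A : Set X, MeasurableSet A →
    ∀ v : ι → ℝ, 0 ≤ v ⬝ᵥ ((Matrix.of fun i j => Φ i j A) *ᵥ v)

/-- A finitely atomic PSD matrix-valued measure `∑_i W_i δ_{x_i}`, with PSD matrices `W_i` and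
distinct points `x_i` of `X`. -/
def IsFinitelyAtomicPSD (Φ : Matrix ι ι (MeasureTheory.SignedMeasure X)) : Prop :=
  IsPSDMatrixMeasure Φ ∧
  ∃ (r : ℕ) (W : Fin r → Matrix ι ι ℝ) (x : Fin r → X),
    (∀ i, (W i).PosSemidef) ∧ Function.Injective x ∧
    ∀ a b, Φ a b = ∑ i, MeasureTheory.VectorMeasure.dirac (x i) (W i a b)

/-- The functional `L_Φ(F) = ∫ tr (F dΦ) = ∑_{i,j} ∫ F_{ij} dφ_{ij}`. -/
def measureFunctional (Φ : Matrix ι ι (MeasureTheory.SignedMeasure X))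
    (F : Matrix ι ι (MvPolynomial (Fin n) ℝ)) : ℝ :=
  ∑ i, ∑ j, MeasureTheory.VectorMeasure.integral (Φ i j) (fun x : X => eval (x : Fin n → ℝ) (F i j))
    (ContinuousLinearMap.lsmul ℝ ℝ)

end MatrixMeasures

/-! ### Robust polynomial matrix inequality problems -/

/-- The data of a robust polynomial matrix inequality problem: minimize `f(y)` over `y ∈ ℝ^ℓ` with
`θ_i(y) ≥ 0` for all `i`, and `P(y, x) ⪰ 0` for all `x ∈ ℝ^n` with `G(x) ⪰ 0`.
The polynomial matrix `P` in `y` and `x` is written as a polynomial matrix in `y` whose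
coefficients are polynomials in `x`. -/
structure Problem (ℓ n s q m : ℕ) where
  f : MvPolynomial (Fin ℓ) ℝ
  θ : Fin s → MvPolynomial (Fin ℓ) ℝ
  G : Matrix (Fin q) (Fin q) (MvPolynomial (Fin n) ℝ)
  P : Matrix (Fin m) (Fin m) (MvPolynomial (Fin ℓ) (MvPolynomial (Fin n) ℝ))
  G_symm : G.IsSymm
  P_symm : P.IsSymm

namespace Problem

variable {ℓ n s q m : ℕ} (prob : Problem ℓ n s q m)

/-- The basic semialgebraic set `Y` of the decision variables. -/
def Y : Set (Fin ℓ → ℝ) := {y | ∀ i, 0 ≤ eval y (prob.θ i)}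

/-- The uncertainty set `X`. -/
def X : Set (Fin n → ℝ) := {x | (evalMat x prob.G).PosSemidef}

/-- For a fixed `x`, the polynomial matrix `P(·, x)` in `y`. -/
def PAt (x : Fin n → ℝ) : Matrix (Fin m) (Fin m) (MvPolynomial (Fin ℓ) ℝ) :=
  prob.P.map (MvPolynomial.map (eval x))

/-- The feasible set of the robust problem. -/
def feasibleSet : Set (Fin ℓ → ℝ) :=
  {y | y ∈ prob.Y ∧ ∀ x ∈ prob.X, (evalMat y (prob.PAt x)).PosSemidef}

/-- The set of optimizers of the robust problem. -/
def optimizers : Set (Fin ℓ → ℝ) :=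
  {y | y ∈ prob.feasibleSet ∧ ∀ z ∈ prob.feasibleSet, eval y prob.f ≤ eval z prob.f}

/-- The optimal value `f⋆` (a genuine infimum whenever there is an optimizer). -/
def fStar : ℝ := sInf ((fun y => eval y prob.f) '' prob.feasibleSet)

/-- SOS-convexity of the problem, and compactness of the uncertainty set. -/
structure SOSConvexity : Prop where
  f_sosConvex : SOSConvex prob.f
  θ_sosConvex : ∀ i, SOSConvex (-prob.θ i)
  P_psdSOSConvex : ∀ x ∈ prob.X, PSDSOSConvex (-prob.PAt x)
  isCompact_X : IsCompact prob.X

/-- The Slater condition. -/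
def Slater : Prop :=
  ∃ y ∈ prob.Y, (∀ i, 0 < eval y (prob.θ i)) ∧ ∀ x ∈ prob.X, (evalMat y (prob.PAt x)).PosDef

/-- `k_y`, the largest degree in `y` of the data. -/
def ky : ℕ := max prob.f.totalDegree
  (max (Finset.univ.sup fun i => (prob.θ i).totalDegree) (matDeg prob.P))

/-- `k_x`, the largest degree in `x` of the data. -/
def kx : ℕ := max
  ((matSupport prob.P).sup fun β => matDeg (coeffMat prob.P β)) (matDeg prob.G)

/-- `L(P(y, x)) = ∑_β L(P_β(x)) y^β`, for a functional `L` on polynomial matrices in `x`. -/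
def applyX (L : Matrix (Fin m) (Fin m) (MvPolynomial (Fin n) ℝ) → ℝ) : MvPolynomial (Fin ℓ) ℝ :=
  ∑ β ∈ matSupport prob.P, monomial β (L (coeffMat prob.P β))

/-- `H_t(P(y, x)) = ∑_β P_β(x) t_β`, for a sequence `t` of pseudo-moments in `y`. -/
def applyY (t : (Fin ℓ →₀ ℕ) → ℝ) : Matrix (Fin m) (Fin m) (MvPolynomial (Fin n) ℝ) :=
  ∑ β ∈ matSupport prob.P, t β • coeffMat prob.P β

/-- The optimal value of the `k`-th primal relaxation: the supremum of `ρ` subject to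
`f - ρ - L_S(P(y, x)) ∈ Q_{⌈k_y/2⌉}(Θ)` and `S ∈ M_k^m(G)`. -/
def fPrimal (k : ℕ) : EReal :=
  ⨆ (ρ : ℝ) (S : (Fin n →₀ ℕ) → Matrix (Fin m) (Fin m) ℝ)
    (_ : S ∈ momentCone (Fin m) k prob.G ∧
      prob.f - C ρ - prob.applyX (riesz S) ∈ scalarQuadModule (halfCeil prob.ky) prob.θ), (ρ : EReal)

/-- The optimal value of the `k`-th dual relaxation: the infimum of `H_t(f)` subject to
`t ∈ M_{⌈k_y/2⌉}(Θ)`, `H_t(1) = 1` and `H_t(P(y, x)) ∈ Q_k^m(G)`. -/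
def fDual (k : ℕ) : EReal :=
  ⨅ (t : (Fin ℓ →₀ ℕ) → ℝ)
    (_ : t ∈ scalarMomentCone (halfCeil prob.ky) prob.θ ∧ scalarRiesz t 1 = 1 ∧
      prob.applyY t ∈ quadModule (Fin m) k prob.G), ((scalarRiesz t prob.f : ℝ) : EReal)

end Problem

end RobustPMI

end

/-! The robust problem is a convex program in `y` with a compact family of concave constraints: the
`θ_i`, and `vᵀ P(y, x) v` for `x` in the compact set `X` and `v` in the unit sphere. Recorded by
their coefficients, they lie in the finite-dimensional `ConstraintSpace`.

Strong duality (`exists_lagrange_multiplier`) comes from an exact penalty, whose size is fixed by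
the Slater point, followed by Sion's minimax theorem. It yields `M ≥ 0` and `b` in the convex hull
of `0` and the constraints such that `f - f⋆ - M b ≥ 0` on all of `ℝ^ℓ`. As a finite convex
combination, `b` equals `∑ c_i θ_i + ∑_x tr (W_x P(y, x))` with `c ≥ 0` and finitely many nonzero
`W_x ⪰ 0`, so a finitely atomic measure appears without any infinite-dimensional duality.

The Lagrangian `f - f⋆ - M b` is SOS-convex, nonnegative, and zero at an optimizer, hence a sum of
squares (`SOSConvex.isSumSq`). The reason is Taylor's formula `p(y) = p(0) + p'(0) y + ∫₀¹ (1 - s)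
yᵀ ∇²p(sy) y ds`, in which an SOS Hessian makes the remainder SOS, while value and gradient vanish
at a minimizer of value zero.

The resulting identity (`exists_certificate`) gives every bound. The truncated moments of the atomic
measure are feasible for the primal problem with `ρ = f⋆`; a dual feasible functional applied to the
identity gives `f⋆ ≤ H_t(f)`. Monotonicity is restriction of moment sequences for the primal, and
inclusion of quadratic modules for the dual. -/

noncomputable section

namespace RobustPMI

/-! ### Sums of squares and SOS-convexity -/

section SumsOfSquares

variable {σ τ ι : Type*}

theorem IsSOSMatrix.transpose_mul_self {κ : Type*} [Fintype κ]
    (T : Matrix κ ι (MvPolynomial σ ℝ)) : IsSOSMatrix (Tᵀ * T) := by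
  refine ⟨Fintype.card κ, T.submatrix (Fintype.equivFin κ).symm id, ?_⟩
  ext1 i j
  simp only [Matrix.mul_apply, Matrix.transpose_apply, Matrix.submatrix_apply, id]
  exact ((Fintype.equivFin κ).symm.sum_comp fun r => T r i * T r j).symm

theorem IsSOSMatrix.zero : IsSOSMatrix (0 : Matrix ι ι (MvPolynomial σ ℝ)) :=
  ⟨0, 0, by ext1 i j; simp [Matrix.mul_apply]⟩

theorem IsSOSMatrix.add {A B : Matrix ι ι (MvPolynomial σ ℝ)} (hA : IsSOSMatrix A)
    (hB : IsSOSMatrix B) : IsSOSMatrix (A + B) := by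
  obtain ⟨k, S, rfl⟩ := hA
  obtain ⟨l, T, rfl⟩ := hB
  convert! IsSOSMatrix.transpose_mul_self (Matrix.fromRows S T) using 1
  ext1 i j
  simp [Matrix.mul_apply, Matrix.fromRows_apply_inl, Matrix.fromRows_apply_inr]

theorem IsSOSMatrix.smul {A : Matrix ι ι (MvPolynomial σ ℝ)} (hA : IsSOSMatrix A) {c : ℝ}
    (hc : 0 ≤ c) : IsSOSMatrix (c • A) := by
  obtain ⟨l, T, rfl⟩ := hA
  refine ⟨l, √c • T, ?_⟩
  rw [Matrix.transpose_smul, Matrix.smul_mul, Matrix.mul_smul, smul_smul, Real.mul_self_sqrt hc]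

theorem IsSOSMatrix.map {A : Matrix ι ι (MvPolynomial σ ℝ)} (hA : IsSOSMatrix A)
    (φ : MvPolynomial σ ℝ →+* MvPolynomial τ ℝ) : IsSOSMatrix (A.map φ) := by
  obtain ⟨l, T, rfl⟩ := hA
  exact ⟨l, T.map φ, by rw [Matrix.map_mul, Matrix.transpose_map]⟩

theorem hessian_add (p q : MvPolynomial σ ℝ) : hessian (p + q) = hessian p + hessian q := by
  ext1 i j; simp [hessian]

theorem hessian_smul (c : ℝ) (p : MvPolynomial σ ℝ) : hessian (c • p) = c • hessian p := by
  ext1 i j; simp [hessian]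

theorem SOSConvex.add {p q : MvPolynomial σ ℝ} (hp : SOSConvex p) (hq : SOSConvex q) :
    SOSConvex (p + q) := by
  rw [SOSConvex, hessian_add]; exact IsSOSMatrix.add hp hq

theorem SOSConvex.smul {p : MvPolynomial σ ℝ} (hp : SOSConvex p) {c : ℝ} (hc : 0 ≤ c) :
    SOSConvex (c • p) := by
  rw [SOSConvex, hessian_smul]; exact IsSOSMatrix.smul hp hc

theorem SOSConvex.C (c : ℝ) : SOSConvex (C c : MvPolynomial σ ℝ) := by
  have : hessian (MvPolynomial.C c : MvPolynomial σ ℝ) = 0 := by ext1 i j; simp [hessian]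
  rw [SOSConvex, this]; exact IsSOSMatrix.zero

theorem SOSConvex.zero : SOSConvex (0 : MvPolynomial σ ℝ) := by
  simpa using SOSConvex.C (σ := σ) 0

theorem exists_eq_sum_mul_self {p : MvPolynomial σ ℝ} (hp : IsSumSq p) :
    ∃ (l : ℕ) (q : Fin l → MvPolynomial σ ℝ), p = ∑ i, q i * q i := by
  induction hp with
  | zero => exact ⟨0, 0, by simp⟩
  | sq_add a _ ih =>
    obtain ⟨l, q, rfl⟩ := ih
    exact ⟨l + 1, Fin.cons a q, by simp [Fin.sum_univ_succ]⟩

theorem IsSumSq.eval_nonneg {p : MvPolynomial σ ℝ} (hp : IsSumSq p) (y : σ → ℝ) :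
    0 ≤ eval y p := by
  obtain ⟨l, q, rfl⟩ := exists_eq_sum_mul_self hp
  simp only [map_sum, map_mul]
  exact Finset.sum_nonneg fun i _ => mul_self_nonneg (eval y (q i))

theorem IsSumSq.map_ringHom {p : MvPolynomial σ ℝ} (hp : IsSumSq p)
    (φ : MvPolynomial σ ℝ →+* MvPolynomial τ ℝ) : IsSumSq (φ p) := by
  obtain ⟨l, q, rfl⟩ := exists_eq_sum_mul_self hp
  simp only [map_sum, map_mul]
  exact IsSumSq.sum fun i _ => IsSumSq.mul_self (φ (q i))

/-- Writing `A = ∑ v vᵀ` turns the form into a sum of squares of the combinations `∑ v_i p_i`. -/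
theorem isSumSq_quadraticForm [Fintype ι] {A : Matrix ι ι ℝ} (hA : A.PosSemidef)
    (p : ι → MvPolynomial σ ℝ) : IsSumSq (∑ i, ∑ j, A i j • (p i * p j)) := by
  obtain ⟨m, v, rfl⟩ := Matrix.posSemidef_iff_eq_sum_vecMulVec.mp hA
  have : ∑ i, ∑ j, (∑ k, vecMulVec (v k) (star (v k))) i j • (p i * p j) =
      ∑ k, (∑ i, v k i • p i) * (∑ i, v k i • p i) := by
    simp only [Matrix.sum_apply, Finset.sum_smul, Finset.sum_mul_sum]
    rw [Finset.sum_congr rfl fun i _ => Finset.sum_comm, Finset.sum_comm]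
    refine Finset.sum_congr rfl fun k _ => Finset.sum_congr rfl fun i _ =>
      Finset.sum_congr rfl fun j _ => ?_
    simp [vecMulVec_apply, smul_smul, mul_comm]
  rw [this]
  exact IsSumSq.sum fun k _ => IsSumSq.mul_self _

-- The entries are the moments `∫₀¹ (1 - s) s^(i+j) ds` of a nonnegative weight, so the quadratic
-- form is the integral of `(1 - s) (∑ x_i s^i)²`. This is the Gram matrix that arises when Taylor's
-- integral remainder is computed degree by degree.
open intervalIntegral in
theorem posSemidef_inv_mul_add (N : ℕ) :
    (Matrix.of fun i j : Fin N =>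
      (((i : ℝ) + j + 2) * ((i : ℝ) + j + 1))⁻¹).PosSemidef := by
  refine Matrix.PosSemidef.of_dotProduct_mulVec_nonneg ?_ fun x => ?_
  · ext i j
    simp [add_comm (i : ℝ)]
  have key (n : ℕ) : ∫ s : ℝ in (0)..1, (1 - s) * s ^ n = (((n : ℝ) + 2) * (n + 1))⁻¹ := by
    have : ∀ s : ℝ, (1 - s) * s ^ n = s ^ n - s ^ (n + 1) := fun s => by ring
    simp only [this]
    rw [integral_sub (by simp) (by simp), integral_pow, integral_pow]
    have h1 : (n : ℝ) + 1 ≠ 0 := by positivity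
    have h2 : (n : ℝ) + 2 ≠ 0 := by positivity
    have h3 : (n : ℝ) + 1 + 1 ≠ 0 := by positivity
    push_cast
    simp
    field_simp
    ring
  have : star x ⬝ᵥ ((Matrix.of fun i j : Fin N =>
      (((i : ℝ) + j + 2) * ((i : ℝ) + j + 1))⁻¹) *ᵥ x) =
      ∫ s : ℝ in (0)..1, (1 - s) * (∑ i : Fin N, x i * s ^ (i : ℕ)) ^ 2 := by
    have h : ∀ s : ℝ, (1 - s) * (∑ i : Fin N, x i * s ^ (i : ℕ)) ^ 2 =
        ∑ i : Fin N, ∑ j : Fin N, x i * x j * ((1 - s) * s ^ ((i : ℕ) + j)) := fun s => by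
      rw [sq, Finset.sum_mul_sum, Finset.mul_sum]
      refine Finset.sum_congr rfl fun i _ => ?_
      rw [Finset.mul_sum]
      exact Finset.sum_congr rfl fun j _ => by ring
    simp only [h]
    rw [integral_finsetSum fun i _ => Continuous.intervalIntegrable (by fun_prop) _ _]
    simp only [dotProduct, mulVec, Finset.mul_sum]
    refine Finset.sum_congr rfl fun i _ => ?_
    rw [integral_finsetSum fun i _ => Continuous.intervalIntegrable (by fun_prop) _ _]
    refine Finset.sum_congr rfl fun j _ => ?_
    rw [integral_const_mul, key]
    simp
    ring
  rw [this]
  exact integral_nonneg (by norm_num) fun s hs => mul_nonneg (by linarith [hs.2]) (sq_nonneg _)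

end SumsOfSquares

/-! ### Translation of the base point -/

section Translation

variable {σ : Type*}

/-- The substitution `y ↦ y + u`. -/
def translate (u : σ → ℝ) : MvPolynomial σ ℝ →ₐ[ℝ] MvPolynomial σ ℝ :=
  aeval fun i => X i + C (u i)

theorem eval_translate (u y : σ → ℝ) (p : MvPolynomial σ ℝ) :
    eval y (translate u p) = eval (y + u) p := by
  have : (aeval y).comp (translate u) = aeval (y + u) := by
    ext i; simp [translate]
  simpa [aeval_eq_eval] using DFunLike.congr_fun this p

theorem translate_neg_translate (u : σ → ℝ) (p : MvPolynomial σ ℝ) :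
    translate (-u) (translate u p) = p := by
  have : (translate (-u)).comp (translate u) = AlgHom.id ℝ _ := by
    ext i; simp [translate]
  exact DFunLike.congr_fun this p

theorem pderiv_translate (u : σ → ℝ) (i : σ) (p : MvPolynomial σ ℝ) :
    pderiv i (translate u p) = translate u (pderiv i p) := by
  classical
  induction p using MvPolynomial.induction_on with
  | C a => simp [translate]
  | add p q hp hq => simp [hp, hq]
  | mul_X p j hp =>
    have hX : translate u (X j) = X j + C (u j) := by simp [translate]
    simp only [map_mul, Derivation.leibniz, hp, hX, map_add, pderiv_C, pderiv_X, smul_eq_mul]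
    by_cases h : j = i <;> simp [h]

/-- Differentiation commutes with translation. Taylor expansions may therefore be taken at the
origin. -/
theorem SOSConvex.translate {p : MvPolynomial σ ℝ} (hp : SOSConvex p) (u : σ → ℝ) :
    SOSConvex (translate u p) := by
  have : hessian (RobustPMI.translate u p) =
      (hessian p).map (RobustPMI.translate u : MvPolynomial σ ℝ →+* MvPolynomial σ ℝ) := by
    ext1 i j
    simp [hessian, pderiv_translate]
  rw [SOSConvex, this]
  exact IsSOSMatrix.map hp _

end Translation

/-! ### Taylor remainder of an SOS-convex polynomial -/

section Taylor

variable {σ : Type*}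

theorem sum_range_homogeneousComponent {p : MvPolynomial σ ℝ} {N : ℕ} (hN : p.totalDegree < N) :
    ∑ d ∈ Finset.range N, homogeneousComponent d p = p := by
  rw [← Finset.sum_subset (Finset.range_mono (Nat.succ_le_of_lt hN)), sum_homogeneousComponent]
  intro d _ hd
  exact homogeneousComponent_eq_zero _ _ (by simpa using hd)

variable [Fintype σ]

/-- Euler's identity is used twice, for `∂_j p` of degree `d - 1` and for `p`. The truncated
subtraction is harmless at `d = 0`, where the other factor `d` vanishes. -/
theorem sum_X_mul_X_mul_hessian_of_isHomogeneous {p : MvPolynomial σ ℝ} {d : ℕ}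
    (hp : p.IsHomogeneous d) :
    ∑ i, ∑ j, X i * X j * hessian p i j = ((d : ℝ) * (d - 1)) • p := by
  have h1 (j : σ) : ∑ i, X i * pderiv i (pderiv j p) = (d - 1) • pderiv j p :=
    hp.pderiv.sum_X_mul_pderiv
  rw [Finset.sum_comm]
  have h2 : ∀ j : σ, ∑ i, X i * X j * hessian p i j = (d - 1) • (X j * pderiv j p) := fun j => by
    rw [← mul_smul_comm, ← h1, Finset.mul_sum]
    exact Finset.sum_congr rfl fun i _ => by simp only [hessian, Matrix.of_apply]; ring
  rw [Finset.sum_congr rfl fun j _ => h2 j, ← Finset.smul_sum, hp.sum_X_mul_pderiv, smul_smul,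
    ← Nat.cast_smul_eq_nsmul ℝ]
  rcases d with _ | d
  · simp
  · simp [mul_comm]

theorem sum_X_mul_X_mul_hessian {p : MvPolynomial σ ℝ} {N : ℕ} (hN : p.totalDegree < N) :
    ∑ i, ∑ j, X i * X j * hessian p i j =
      ∑ d ∈ Finset.range N, ((d : ℝ) * (d - 1)) • homogeneousComponent d p := by
  conv_lhs => rw [← sum_range_homogeneousComponent hN]
  have h (d : ℕ) := sum_X_mul_X_mul_hessian_of_isHomogeneous
    (homogeneousComponent_isHomogeneous d p)
  simp_rw [← h]
  symm
  rw [Finset.sum_comm]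
  refine Finset.sum_congr rfl fun i _ => ?_
  rw [Finset.sum_comm]
  refine Finset.sum_congr rfl fun j _ => ?_
  simp [hessian, Finset.mul_sum]

/-- Multiplication of the homogeneous component of degree `d` by `1 / (d (d - 1))`, for `2 ≤ d < N`;
the other components are deleted. -/
def invEuler (N : ℕ) : MvPolynomial σ ℝ →ₗ[ℝ] MvPolynomial σ ℝ :=
  ∑ d ∈ Finset.range N, ((d : ℝ) * (d - 1))⁻¹ • homogeneousComponent d

omit [Fintype σ] in
theorem invEuler_of_isHomogeneous {N d : ℕ} (hd : d < N) {p : MvPolynomial σ ℝ}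
    (hp : p.IsHomogeneous d) : invEuler N p = ((d : ℝ) * (d - 1))⁻¹ • p := by
  rw [invEuler, LinearMap.sum_apply, Finset.sum_eq_single d]
  · simp [homogeneousComponent_eq_self hp]
  · intro e _ he
    simp [homogeneousComponent_of_mem ((mem_homogeneousSubmodule d p).2 hp), he]
  · simp [hd]

/-- An SOS-convex polynomial is a sum of squares up to its Taylor polynomial of degree one. -/
theorem SOSConvex.isSumSq_sub_homogeneousComponent {p : MvPolynomial σ ℝ} (hp : SOSConvex p) :
    IsSumSq (p - homogeneousComponent 0 p - homogeneousComponent 1 p) := by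
  obtain ⟨l, T, hT⟩ := hp
  -- With `∇²p = Tᵀ T`, the form `yᵀ ∇²p(y) y` is `∑ q_r²`. By Euler's identity it also equals `∑ d
  -- (d - 1) p_d`, so `invEuler` recovers the Taylor remainder from it; what remains is that
  -- `invEuler` sends each `q_r²` to a sum of squares.
  let q : Fin l → MvPolynomial σ ℝ := fun r => ∑ j, X j * T r j
  have hq : ∑ i, ∑ j, X i * X j * hessian p i j = ∑ r, q r * q r := by
    simp only [q, Finset.sum_mul_sum]
    simp only [hT, Matrix.mul_apply, Matrix.transpose_apply, Finset.mul_sum]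
    rw [Finset.sum_congr rfl fun i _ => Finset.sum_comm, Finset.sum_comm]
    exact Finset.sum_congr rfl fun r _ => Finset.sum_congr rfl fun i _ =>
      Finset.sum_congr rfl fun j _ => by ring
  obtain ⟨M, hpM, hqM⟩ : ∃ M : ℕ, p.totalDegree < M + 2 ∧ ∀ r, (q r).totalDegree < M + 1 := by
    refine ⟨p.totalDegree + Finset.univ.sup fun r => (q r).totalDegree, by omega, fun r => ?_⟩
    have := Finset.le_sup (f := fun r => (q r).totalDegree) (Finset.mem_univ r)
    omega
  -- No constant term occurs in `q r`, so every product of two components has degree at least 2,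
  -- where `invEuler` divides by a nonzero number.
  have hq' (r : Fin l) : q r = ∑ i : Fin M, homogeneousComponent (i + 1) (q r) := by
    conv_lhs => rw [← sum_range_homogeneousComponent (hqM r), Finset.sum_range_succ']
    have h0 : homogeneousComponent 0 (q r) = 0 := by
      rw [homogeneousComponent_zero]
      simp [q, ← constantCoeff_eq]
    rw [h0, add_zero, Finset.sum_range]
  have hN (i j : Fin M) : (i : ℕ) + 1 + (j + 1) < 2 * M + 2 := by omega
  have e1 : p - homogeneousComponent 0 p - homogeneousComponent 1 p =
      invEuler (2 * M + 2) (∑ i, ∑ j, X i * X j * hessian p i j) := by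
    have e := sum_range_homogeneousComponent hpM
    rw [Finset.sum_range_succ', Finset.sum_range_succ'] at e
    rw [sum_X_mul_X_mul_hessian hpM, map_sum, Finset.sum_range_succ', Finset.sum_range_succ']
    have hM (d : ℕ) (hd : d ∈ Finset.range M) :
        invEuler (2 * M + 2) ((((d + 1 + 1 : ℕ) : ℝ) * ((d + 1 + 1 : ℕ) - 1)) •
          homogeneousComponent (d + 1 + 1) p) = homogeneousComponent (d + 1 + 1) p := by
      rw [map_smul, invEuler_of_isHomogeneous (d := d + 1 + 1) _
        (homogeneousComponent_isHomogeneous _ p), smul_smul, mul_inv_cancel₀, one_smul]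
      · push_cast
        have : (0 : ℝ) < (d + 1 + 1) * (d + 1 + 1 - 1) := by
          have : (0 : ℝ) ≤ d := d.cast_nonneg
          nlinarith
        exact this.ne'
      · have := Finset.mem_range.1 hd
        omega
    rw [Finset.sum_congr rfl hM]
    simp only [zero_add, Nat.cast_zero, Nat.cast_one, zero_mul, zero_smul, sub_self, mul_zero,
      map_zero, add_zero] at e ⊢
    linear_combination -e
  -- The components of index `i` and `j` have degrees `i + 1` and `j + 1`; with `d = i + j + 2` the
  -- factor `1 / (d (d - 1))` is the entry of the positive semidefinite matrix above.
  have e2 (r : Fin l) : invEuler (2 * M + 2) (q r * q r) =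
      ∑ i : Fin M, ∑ j : Fin M, (Matrix.of fun i j : Fin M =>
        (((i : ℝ) + j + 2) * ((i : ℝ) + j + 1))⁻¹) i j •
        (homogeneousComponent (i + 1) (q r) * homogeneousComponent (j + 1) (q r)) := by
    conv_lhs => rw [hq' r]
    rw [Finset.sum_mul_sum, map_sum]
    refine Finset.sum_congr rfl fun i _ => ?_
    rw [map_sum]
    refine Finset.sum_congr rfl fun j _ => ?_
    rw [invEuler_of_isHomogeneous (hN i j) ((homogeneousComponent_isHomogeneous _ _).mul
      (homogeneousComponent_isHomogeneous _ _)), Matrix.of_apply]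
    congr 2
    push_cast
    ring
  rw [e1, hq, map_sum]
  exact IsSumSq.sum fun r _ => by
    rw [e2]
    exact isSumSq_quadraticForm (posSemidef_inv_mul_add M) _

theorem eval_smul_of_isHomogeneous {p : MvPolynomial σ ℝ} {d : ℕ} (hp : p.IsHomogeneous d)
    (c : ℝ) (y : σ → ℝ) : eval (c • y) p = c ^ d * eval y p := by
  rw [eval_eq', eval_eq', Finset.mul_sum]
  refine Finset.sum_congr rfl fun α hα => ?_
  have : ∑ i, α i = d := by
    rw [← Finsupp.degree_eq_sum]
    by_contra h
    exact mem_support_iff.1 hα (hp.coeff_eq_zero h)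
  simp only [Pi.smul_apply, smul_eq_mul, mul_pow, Finset.prod_mul_distrib,
    Finset.prod_pow_eq_pow_sum, this]
  ring

/-- The Taylor remainder at `w = a y + b z` is a sum of squares, so the graph lies above its tangent
at `w`. In the weighted sum of the tangent inequalities at `y` and `z` the linear terms cancel. -/
theorem SOSConvex.convexOn {p : MvPolynomial σ ℝ} (hp : SOSConvex p) :
    ConvexOn ℝ Set.univ fun y => eval y p := by
  refine ⟨convex_univ, fun y _ z _ a b ha hb hab => ?_⟩
  set w := a • y + b • z with hw
  set g := homogeneousComponent 1 (RobustPMI.translate w p)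
  have key (v : σ → ℝ) : eval w p + eval (v - w) g ≤ eval v p := by
    have := IsSumSq.eval_nonneg (hp.translate w).isSumSq_sub_homogeneousComponent (v - w)
    rw [map_sub, map_sub, eval_translate, homogeneousComponent_zero, eval_C, ← constantCoeff_eq,
      ← eval_zero, eval_translate] at this
    simp only [sub_add_cancel, zero_add] at this
    linarith
  have hg : g.IsHomogeneous 1 := homogeneousComponent_isHomogeneous 1 _
  have hy : y - w = b • (y - z) := by
    rw [hw, eq_sub_of_add_eq hab]; module
  have hz : z - w = (-a) • (y - z) := by
    rw [hw, eq_sub_of_add_eq' hab]; module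
  have h1 := key y
  have h2 := key z
  rw [hy, eval_smul_of_isHomogeneous hg] at h1
  rw [hz, eval_smul_of_isHomogeneous hg] at h2
  simp only [smul_eq_mul, pow_one] at h1 h2 ⊢
  have := add_le_add (mul_le_mul_of_nonneg_left h1 ha) (mul_le_mul_of_nonneg_left h2 hb)
  have e : eval w p = a * eval w p + b * eval w p := by rw [← add_mul, hab, one_mul]
  linarith

/-- A nonnegative SOS-convex polynomial with a zero is a sum of squares. -/
theorem SOSConvex.isSumSq {p : MvPolynomial σ ℝ} (hp : SOSConvex p) (hnonneg : ∀ y, 0 ≤ eval y p)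
    {u : σ → ℝ} (hu : eval u p = 0) : IsSumSq p := by
  set g := RobustPMI.translate u p with hg
  have hg_nonneg (y : σ → ℝ) : 0 ≤ eval y g := by rw [hg, eval_translate]; exact hnonneg _
  have hg_zero : eval 0 g = 0 := by rw [hg, eval_translate, zero_add, hu]
  have h0 : homogeneousComponent 0 g = 0 := by
    rw [homogeneousComponent_zero, ← constantCoeff_eq, ← eval_zero, hg_zero, C_0]
  -- The linear part vanishes because `0` minimizes `g`: its value at `y` is the derivative at `0`
  -- of the one-variable polynomial `t ↦ g(t y)`.
  have h1 : homogeneousComponent 1 g = 0 := by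
    refine MvPolynomial.funext fun y => ?_
    let P : Polynomial ℝ := ∑ d ∈ Finset.range (g.totalDegree + 2),
      Polynomial.monomial d (eval y (homogeneousComponent d g))
    have hP (t : ℝ) : P.eval t = eval (t • y) g := by
      conv_rhs => rw [← sum_range_homogeneousComponent (N := g.totalDegree + 2) (p := g) (by omega)]
      rw [Polynomial.eval_finsetSum, map_sum]
      refine Finset.sum_congr rfl fun d _ => ?_
      rw [Polynomial.eval_monomial, eval_smul_of_isHomogeneous
        (homogeneousComponent_isHomogeneous d g), mul_comm]
    have hmin : IsLocalMin (fun t => P.eval t) 0 := Filter.Eventually.of_forall fun t => by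
      simp only [hP, zero_smul, hg_zero, hg_nonneg]
    have hcoeff := hmin.deriv_eq_zero
    rw [Polynomial.deriv, ← Polynomial.coeff_zero_eq_eval_zero, Polynomial.coeff_derivative] at hcoeff
    simpa [P, Polynomial.finsetSum_coeff, Polynomial.coeff_monomial] using hcoeff
  have := (hp.translate u).isSumSq_sub_homogeneousComponent
  rw [← hg, h0, h1, sub_zero, sub_zero] at this
  rw [← translate_neg_translate u p]
  exact IsSumSq.map_ringHom this (RobustPMI.translate (-u)).toRingHom

end Taylor

/-! ### Degrees in sums of squares -/

section Degree

variable {σ : Type*}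

theorem totalDegree_sum_range_homogeneousComponent_le (p : MvPolynomial σ ℝ) (d : ℕ) :
    (∑ e ∈ Finset.range (d + 1), homogeneousComponent e p).totalDegree ≤ d := by
  refine totalDegree_finsetSum_le fun e he => ?_
  exact (homogeneousComponent_isHomogeneous e p).totalDegree_le.trans
    (Nat.lt_succ_iff.1 (Finset.mem_range.1 he))

theorem homogeneousComponent_mul_self {p : MvPolynomial σ ℝ} {d : ℕ}
    (hp : p.totalDegree ≤ d + 1) :
    homogeneousComponent (2 * (d + 1)) (p * p) =
      homogeneousComponent (d + 1) p * homogeneousComponent (d + 1) p := by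
  set a := homogeneousComponent (d + 1) p with ha
  set r := ∑ e ∈ Finset.range (d + 1), homogeneousComponent e p with hr
  have hpa : p = r + a := by
    conv_lhs => rw [← sum_range_homogeneousComponent (Nat.lt_succ_of_le hp)]
    rw [Finset.sum_range_succ]
  have ha' : a.IsHomogeneous (d + 1) := homogeneousComponent_isHomogeneous _ _
  have hr' : r.totalDegree ≤ d := totalDegree_sum_range_homogeneousComponent_le p d
  have e : p * p = a * a + (p + a) * r := by rw [hpa]; ring
  have hdeg : ((p + a) * r).totalDegree < 2 * (d + 1) := by
    have h1 := totalDegree_mul (p + a) r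
    have h2 : (p + a).totalDegree ≤ d + 1 :=
      (totalDegree_add _ _).trans (max_le hp ha'.totalDegree_le)
    omega
  have haa : (a * a).IsHomogeneous (2 * (d + 1)) := two_mul (d + 1) ▸ ha'.mul ha'
  rw [e, map_add, homogeneousComponent_eq_zero _ _ hdeg, add_zero,
    homogeneousComponent_eq_self haa]

/-- Squares of leading components cannot cancel over `ℝ`, so a common degree bound above `k` can be
lowered one step at a time. The bound is needed because a truncated moment matrix only controls
squares of polynomials of degree at most `k`. -/
theorem totalDegree_le_of_sum_mul_self [Finite σ] {l : ℕ} {q : Fin l → MvPolynomial σ ℝ} {k : ℕ}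
    (h : (∑ i, q i * q i).totalDegree ≤ 2 * k) (i : Fin l) : (q i).totalDegree ≤ k := by
  have := Fintype.ofFinite σ
  have step (d : ℕ) (hd : k ≤ d) : (∀ i, (q i).totalDegree ≤ d) → ∀ i, (q i).totalDegree ≤ k := by
    induction d, hd using Nat.le_induction with
    | base => exact id
    | succ d hd ih =>
      refine fun hq => ih fun i => ?_
      have hsum : ∑ i, homogeneousComponent (d + 1) (q i) * homogeneousComponent (d + 1) (q i) =
          0 := by
        rw [← Finset.sum_congr rfl fun i _ => homogeneousComponent_mul_self (hq i), ← map_sum]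
        exact homogeneousComponent_eq_zero _ _ (by omega)
      have hzero : homogeneousComponent (d + 1) (q i) = 0 := by
        refine MvPolynomial.funext fun y => ?_
        have hy := congrArg (eval y) hsum
        simp only [map_sum, map_mul, map_zero] at hy
        have := (Finset.sum_eq_zero_iff_of_nonneg fun i _ =>
          mul_self_nonneg (eval y (homogeneousComponent (d + 1) (q i)))).1 hy i (Finset.mem_univ i)
        simpa using this
      rw [← sum_range_homogeneousComponent (Nat.lt_succ_of_le (hq i)), Finset.sum_range_succ,
        hzero, add_zero]
      exact totalDegree_sum_range_homogeneousComponent_le (q i) d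
  refine step (k + Finset.univ.sup fun i => (q i).totalDegree) (by omega) (fun i => ?_) i
  have := Finset.le_sup (f := fun i => (q i).totalDegree) (Finset.mem_univ i)
  omega

end Degree

/-! ### Convex duality under the Slater condition -/

section ConvexDuality

/-- In finite dimension, the convex hull of a compact set is compact. -/
theorem isCompact_convexHull {V : Type*} [NormedAddCommGroup V] [NormedSpace ℝ V]
    [FiniteDimensional ℝ V] {K : Set V} (hK : IsCompact K) : IsCompact (convexHull ℝ K) := by
  rcases K.eq_empty_or_nonempty with rfl | ⟨k₀, hk₀⟩
  -- By Carathéodory's theorem `finrank + 1` points suffice, so the hull is a continuous image of a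
  -- simplex times a power of `K`. Shorter combinations are padded with weight `0` at `k₀`.
  · simp
  let d := Module.finrank ℝ V + 1
  have hcpt : IsCompact ((fun p : (Fin d → ℝ) × (Fin d → V) => ∑ i, p.1 i • p.2 i) ''
      (stdSimplex ℝ (Fin d) ×ˢ Set.univ.pi fun _ => K)) :=
    ((isCompact_stdSimplex ℝ (Fin d)).prod (isCompact_univ_pi fun _ => hK)).image (by fun_prop)
  convert! hcpt using 1
  refine Set.Subset.antisymm (fun x hx => ?_) ?_
  · obtain ⟨ι, _, z, w, hz, hind, hw, hw1, rfl⟩ := eq_pos_convex_span_of_mem_convexHull hx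
    obtain ⟨e⟩ : Nonempty (ι ↪ Fin d) := Function.Embedding.nonempty_of_card_le (by
      have := hind.card_le_finrank_succ
      have h2 : Module.finrank ℝ (vectorSpan ℝ (Set.range z)) ≤ Module.finrank ℝ V :=
        Submodule.finrank_le _
      simp only [Fintype.card_fin, d]
      omega)
    refine ⟨(Function.extend e w 0, Function.extend e z fun _ => k₀), ⟨⟨fun j => ?_, ?_⟩, ?_⟩, ?_⟩
    · by_cases h : ∃ i, e i = j
      · obtain ⟨i, rfl⟩ := h
        simpa [e.injective.extend_apply] using (hw i).le
      · simp [Function.extend_apply' _ _ _ h]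
    · rw [← hw1]
      refine (Fintype.sum_of_injective e e.injective _ _ (fun j hj => ?_) fun i => ?_).symm
      · exact Function.extend_apply' _ _ _ hj
      · exact (e.injective.extend_apply _ _ _).symm
    · intro j _
      by_cases h : ∃ i, e i = j
      · obtain ⟨i, rfl⟩ := h
        simpa [e.injective.extend_apply] using hz ⟨i, rfl⟩
      · simpa [Function.extend_apply' _ _ _ h] using hk₀
    · refine (Fintype.sum_of_injective e e.injective _ _ (fun j hj => ?_) fun i => ?_).symm
      · simp only [Function.extend_apply' _ _ _ hj, Pi.zero_apply, zero_smul]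
      · simp only [e.injective.extend_apply]
  · rintro _ ⟨⟨w, z⟩, ⟨hw, hz⟩, rfl⟩
    exact (convex_convexHull ℝ K).sum_mem (fun i _ => hw.1 i) hw.2
      fun i _ => subset_convexHull ℝ K (hz i (Set.mem_univ i))

/-- Lagrange multipliers for a convex program with a compact family of concave constraints,
under the Slater condition. The constraints are `0 ≤ L y g` for `g` in the compact set `T`. -/
theorem exists_lagrange_multiplier {V F : Type*} [NormedAddCommGroup V] [NormedSpace ℝ V]
    [FiniteDimensional ℝ V] [NormedAddCommGroup F] [NormedSpace ℝ F]
    {f : F → ℝ} (hf : ConvexOn ℝ Set.univ f) (hfc : Continuous f) {T : Set V} (hT : IsCompact T)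
    (L : F → V →ₗ[ℝ] ℝ) (hLc : ∀ g, Continuous fun y => L y g)
    (hL : ∀ g ∈ T, ConcaveOn ℝ Set.univ fun y => L y g) {y₀ : F} (hy₀ : ∀ g ∈ T, 0 < L y₀ g)
    {c : ℝ} (hc : ∀ y, (∀ g ∈ T, 0 ≤ L y g) → c ≤ f y) :
    ∃ M : ℝ, 0 ≤ M ∧ ∃ b ∈ convexHull ℝ (insert 0 T), ∀ y, c ≤ f y - M * L y b := by
  have hLV (y : F) : Continuous (L y) := (L y).continuous_of_finiteDimensional
  obtain ⟨δ, hδ, hδT⟩ : ∃ δ > 0, ∀ g ∈ T, δ ≤ L y₀ g := by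
    rcases T.eq_empty_or_nonempty with rfl | hne
    · exact ⟨1, one_pos, by simp⟩
    · obtain ⟨g, hg, hmin⟩ := hT.exists_isMinOn hne (hLV y₀).continuousOn
      exact ⟨L y₀ g, hy₀ g hg, fun g' hg' => hmin hg'⟩
  set B := convexHull ℝ (insert 0 T) with hB
  have hBcpt : IsCompact B := isCompact_convexHull (hT.insert 0)
  have hBconv : Convex ℝ B := convex_convexHull ℝ _
  have h0B : (0 : V) ∈ B := subset_convexHull ℝ _ (Set.mem_insert _ _)
  have hTB {g : V} (hg : g ∈ T) : g ∈ B := subset_convexHull ℝ _ (Set.mem_insert_of_mem _ hg)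
  set M := (f y₀ - c) / δ with hM
  have hfy₀ : 0 ≤ f y₀ - c := sub_nonneg.2 (hc y₀ fun g hg => (hy₀ g hg).le)
  have hM0 : 0 ≤ M := div_nonneg hfy₀ hδ.le
  -- Exact penalty: if the worst constraint at `y` has value `-ε < 0`, moving towards `y₀` with
  -- weight `ε / (δ + ε)` restores feasibility, since every constraint is at least `δ` at `y₀`.
  -- Convexity of `f` then gives `c ≤ f y + M ε` for this `M`. At a feasible `y` the choice `b = 0`
  -- works, which is why `0` was adjoined.
  have hpen (y : F) : ∃ b ∈ B, c ≤ f y - M * L y b := by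
    by_cases hy : ∀ g ∈ T, 0 ≤ L y g
    · exact ⟨0, h0B, by simpa using hc y hy⟩
    push Not at hy
    obtain ⟨g₁, hg₁, hneg⟩ := hy
    obtain ⟨g, hg, hmin⟩ := hT.exists_isMinOn ⟨g₁, hg₁⟩ (hLV y).continuousOn
    have hg0 : L y g < 0 := (hmin hg₁).trans_lt hneg
    refine ⟨g, hTB hg, ?_⟩
    set ε := -L y g with hε
    have hε0 : 0 < ε := by linarith
    have hs : 0 < δ + ε := by positivity
    have hab : δ / (δ + ε) + ε / (δ + ε) = 1 := by field_simp
    have hz := hc ((δ / (δ + ε)) • y + (ε / (δ + ε)) • y₀) fun g' hg' => by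
      refine le_trans ?_ ((hL g' hg').2 (Set.mem_univ y) (Set.mem_univ y₀)
        (by positivity) (by positivity) hab)
      have h1 : -ε ≤ L y g' := by rw [hε, neg_neg]; exact hmin hg'
      have h2 := hδT g' hg'
      have : 0 ≤ (δ * L y g' + ε * L y₀ g') / (δ + ε) :=
        div_nonneg (by nlinarith) hs.le
      simp only [smul_eq_mul]
      convert! this using 1
      ring
    have hz' := hz.trans (hf.2 (Set.mem_univ y) (Set.mem_univ y₀) (by positivity) (by positivity)
      hab)
    have e : (δ / (δ + ε)) • f y + (ε / (δ + ε)) • f y₀ = (δ * f y + ε * f y₀) / (δ + ε) := by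
      simp only [smul_eq_mul]; ring
    rw [e, le_div_iff₀ hs] at hz'
    have hMδ : M * δ = f y₀ - c := div_mul_cancel₀ _ hδ.ne'
    have hLy : L y g = -ε := by rw [hε, neg_neg]
    rw [hLy]
    refine le_of_mul_le_mul_right ?_ hδ
    calc c * δ ≤ δ * f y + ε * (f y₀ - c) := by linarith
      _ = (f y - M * -ε) * δ := by rw [← hMδ]; ring
  refine ⟨M, hM0, ?_⟩
  -- So far `b` depends on `y`; minimax exchanges the quantifiers. If no single `b` works,
  -- compactness of `B` leaves finitely many `y` that refute every `b`, and Sion's theorem merges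
  -- them into one `y`, which contradicts `hpen`.
  by_contra! hcon
  have hconc : ∀ b ∈ B, ConcaveOn ℝ Set.univ fun y => L y b := by
    have : Convex ℝ {b : V | ConcaveOn ℝ Set.univ fun y => L y b} := by
      intro b hb b' hb' r r' hr hr' _
      have h1 : ConcaveOn ℝ Set.univ fun y => L y b := hb
      have h2 : ConcaveOn ℝ Set.univ fun y => L y b' := hb'
      simpa [Pi.add_def] using (h1.smul hr).add (h2.smul hr')
    have h0 : ConcaveOn ℝ Set.univ fun y => L y 0 := by
      simpa using concaveOn_const (𝕜 := ℝ) (0 : ℝ) (convex_univ (E := F))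
    exact convexHull_min (Set.insert_subset h0 hL) this
  have hopen (y : F) : IsOpen {b : V | -c < M * L y b - f y} :=
    isOpen_lt continuous_const (((hLV y).const_mul M).sub continuous_const)
  obtain ⟨s, hs⟩ := hBcpt.elim_finite_subcover _ hopen fun b hb => by
    obtain ⟨y, hy⟩ := hcon b hb
    exact Set.mem_iUnion.2 ⟨y, by simp only [Set.mem_ofPred_eq]; linarith⟩
  obtain ⟨y, -, hy⟩ := Sion.exists_lt_iInf_of_lt_iInf_of_finite (X := B) (Y := Set.univ)
    (f := fun b y => M * L y b - f y) (t := -c) (s := (s : Set F)) ⟨0, h0B⟩ hBcpt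
    (fun y _ => (((hLV y).const_mul M).sub continuous_const).lowerSemicontinuous.lowerSemicontinuousOn _)
    (fun y _ => by
      refine ConvexOn.quasiconvexOn ⟨hBconv, fun b _ b' _ r r' _ _ h => ?_⟩
      simp only [map_add, map_smul, smul_eq_mul]
      rw [eq_sub_of_add_eq h]
      apply le_of_eq
      ring)
    convex_univ
    (fun b _ => (((hLc b).const_mul M).sub hfc).upperSemicontinuous.upperSemicontinuousOn _)
    (fun b hb => by
      have := ((hconc b hb).smul hM0).sub hf
      exact this.quasiconcaveOn)
    hBconv s.finite_toSet (Set.subset_univ _)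
    (fun b hb => by simpa using hs hb)
  obtain ⟨b, hb, hle⟩ := hpen y
  have := hy b hb
  linarith

end ConvexDuality

/-! ### Polynomial matrices, block pairings and traces -/

section PolynomialMatrixLemmas

variable {σ ι κ : Type*} [Fintype ι]

theorem isSOSMatrix_diagonal_C [DecidableEq ι] {c : ι → ℝ} (hc : 0 ≤ c) :
    IsSOSMatrix (Matrix.diagonal fun i => (C (c i) : MvPolynomial σ ℝ)) := by
  convert! IsSOSMatrix.transpose_mul_self
    (Matrix.diagonal fun i => (C (√(c i)) : MvPolynomial σ ℝ)) using 1
  rw [Matrix.diagonal_transpose, Matrix.diagonal_mul_diagonal]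
  congr 1
  ext1 i
  rw [← C_mul, Real.mul_self_sqrt (hc i)]

theorem blockPairing_apply {R : Type*} [CommSemiring R] [DecidableEq ι] [Fintype κ]
    (A : Matrix (ι × κ) (ι × κ) R) (B : Matrix κ κ R) (i j : ι) :
    blockPairing A B i j = ∑ a, ∑ b, A (j, b) (i, a) * B b a := by
  simp [blockPairing, Matrix.mul_apply, Fintype.sum_prod_type, Matrix.one_apply]

theorem blockPairing_diagonal_diagonal {R : Type*} [CommSemiring R] [DecidableEq ι] [Fintype κ]
    [DecidableEq κ] (c : ι × κ → R) (θ : κ → R) :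
    blockPairing (Matrix.diagonal c) (Matrix.diagonal θ) =
      Matrix.diagonal fun i => ∑ a, c (i, a) * θ a := by
  ext i j
  rw [blockPairing_apply, Matrix.diagonal_apply]
  by_cases h : i = j
  · subst h
    simp [Matrix.diagonal_apply]
  · simp [Matrix.diagonal_apply, h, Ne.symm h]

theorem mem_matSupport {R : Type*} [CommSemiring R] [Fintype κ]
    {F : Matrix ι κ (MvPolynomial σ R)} {α : σ →₀ ℕ} :
    α ∈ matSupport F ↔ coeffMat F α ≠ 0 := by
  simp [matSupport, coeffMat, ← Matrix.ext_iff, Finset.mem_biUnion]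

theorem totalDegree_le_matDeg {R : Type*} [CommSemiring R] [Fintype κ]
    (F : Matrix ι κ (MvPolynomial σ R)) (i : ι) (j : κ) : (F i j).totalDegree ≤ matDeg F :=
  (Finset.le_sup (f := fun j => (F i j).totalDegree) (Finset.mem_univ j)).trans
    (Finset.le_sup (f := fun i => Finset.univ.sup fun j => (F i j).totalDegree)
      (Finset.mem_univ i))

theorem degree_le_matDeg {R : Type*} [CommSemiring R] [Fintype κ]
    {F : Matrix ι κ (MvPolynomial σ R)} {α : σ →₀ ℕ} (hα : α ∈ matSupport F) :
    α.degree ≤ matDeg F := by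
  simp only [matSupport, Finset.mem_biUnion] at hα
  obtain ⟨i, _, j, _, h⟩ := hα
  exact (le_totalDegree h).trans (totalDegree_le_matDeg F i j)

theorem le_two_mul_halfCeil (d : ℕ) : d ≤ 2 * halfCeil d := by
  unfold halfCeil; omega

/-- Taking `Σ₁` constant and diagonal, with entries `c_i`, makes the degree condition one on the
`θ_i` alone. -/
theorem mem_scalarQuadModule {s k : ℕ} {θ : Fin s → MvPolynomial σ ℝ} {p : MvPolynomial σ ℝ}
    {c : Fin s → ℝ} (hp : IsSumSq p) (hc : 0 ≤ c) (hpk : p.totalDegree ≤ 2 * k)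
    (hθ : ∀ i, (θ i).totalDegree ≤ 2 * k) : p + ∑ i, c i • θ i ∈ scalarQuadModule k θ := by
  have hdiag (q : MvPolynomial σ ℝ) : (Matrix.of fun _ _ => q : Matrix (Fin 1) (Fin 1) _) =
      Matrix.diagonal fun _ => q := by
    ext1 i j
    simp [Subsingleton.elim i j]
  have hdeg (q : MvPolynomial σ ℝ) (h : q.totalDegree ≤ 2 * k) :
      matDeg (Matrix.diagonal fun _ : Fin 1 => q) ≤ 2 * k := by
    refine Finset.sup_le fun i _ => Finset.sup_le fun j _ => ?_
    simpa [Subsingleton.elim i j] using h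
  have hpair : blockPairing (Matrix.diagonal fun a : Fin 1 × Fin s => C (c a.2))
      (Matrix.diagonal θ) = Matrix.diagonal fun _ => ∑ i, c i • θ i := by
    rw [blockPairing_diagonal_diagonal]
    simp only [smul_eq_C_mul]
  refine ⟨Matrix.diagonal fun _ => p, Matrix.diagonal fun a => C (c a.2), ?_,
    isSOSMatrix_diagonal_C fun a => hc a.2, hdeg _ hpk, ?_, ?_⟩
  · obtain ⟨l, q, rfl⟩ := exists_eq_sum_mul_self hp
    refine ⟨l, Matrix.of fun r _ => q r, ?_⟩
    rw [← hdiag]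
    ext1 i j
    simp [Matrix.mul_apply]
  · rw [hpair]
    exact hdeg _ (totalDegree_finsetSum_le fun i _ => (totalDegree_smul_le _ _).trans (hθ i))
  · rw [hpair, hdiag, Matrix.diagonal_add]

theorem trace_vecMulVec_mul {R : Type*} [CommSemiring R] (v w : ι → R) (A : Matrix ι ι R) :
    (vecMulVec v w * A).trace = w ⬝ᵥ (A *ᵥ v) := by
  rw [vecMulVec_eq (Fin 1)]
  simp only [Matrix.trace, Matrix.mul_apply, dotProduct, mulVec, Finset.mul_sum, Finset.univ_unique,
    Finset.sum_singleton, Matrix.replicateCol_apply, Matrix.replicateRow_apply, Matrix.diag_apply]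
  rw [Finset.sum_comm]
  exact Finset.sum_congr rfl fun i _ => Finset.sum_congr rfl fun j _ => by ring

theorem trace_mul_nonneg {W A : Matrix ι ι ℝ} (hW : W.PosSemidef) (hA : A.PosSemidef) :
    0 ≤ (W * A).trace := by
  obtain ⟨m, v, rfl⟩ := Matrix.posSemidef_iff_eq_sum_vecMulVec.mp hW
  rw [Finset.sum_mul, Matrix.trace_sum]
  refine Finset.sum_nonneg fun i _ => ?_
  rw [trace_vecMulVec_mul]
  exact hA.dotProduct_mulVec_nonneg (v i)

end PolynomialMatrixLemmas

/-! ### Functionals of finitely supported matrix families -/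

section AtomicFunctional

variable {n : ℕ} {X : Set (Fin n → ℝ)} {ι : Type*} [Fintype ι]

/-- The functional `F ↦ ∑_x tr (W_x F(x))` of a finitely supported family of matrices. -/
def atomicFunctional (w : X →₀ Matrix ι ι ℝ) (F : Matrix ι ι (MvPolynomial (Fin n) ℝ)) : ℝ :=
  w.sum fun x W => (W * evalMat (x : Fin n → ℝ) F).trace

theorem atomicFunctional_add (w w' : X →₀ Matrix ι ι ℝ)
    (F : Matrix ι ι (MvPolynomial (Fin n) ℝ)) :
    atomicFunctional (w + w') F = atomicFunctional w F + atomicFunctional w' F :=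
  Finsupp.sum_add_index' (by simp) (by simp [add_mul])

theorem atomicFunctional_smul (c : ℝ) (w : X →₀ Matrix ι ι ℝ)
    (F : Matrix ι ι (MvPolynomial (Fin n) ℝ)) :
    atomicFunctional (c • w) F = c * atomicFunctional w F := by
  rw [atomicFunctional, Finsupp.sum_smul_index' (by simp), atomicFunctional, Finsupp.mul_sum]
  simp

end AtomicFunctional

/-! ### Coefficients of `P` as a polynomial in `y` -/

namespace Problem

variable {ℓ n s q m : ℕ} (prob : Problem ℓ n s q m)

/-- No linearity of `L` enters; `L 0 = 0` accounts for the exponents outside `matSupport`. -/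
theorem coeff_applyX {L : Matrix (Fin m) (Fin m) (MvPolynomial (Fin n) ℝ) → ℝ} (hL : L 0 = 0)
    (β : Fin ℓ →₀ ℕ) : coeff β (prob.applyX L) = L (coeffMat prob.P β) := by
  classical
  rw [applyX, coeff_sum]
  simp only [coeff_monomial, Finset.sum_ite_eq']
  split_ifs with h
  · rfl
  · rw [mem_matSupport, not_not] at h
    rw [h, hL]

theorem totalDegree_applyX_le (L : Matrix (Fin m) (Fin m) (MvPolynomial (Fin n) ℝ) → ℝ) :
    (prob.applyX L).totalDegree ≤ matDeg prob.P := by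
  refine totalDegree_finsetSum_le fun β hβ => (totalDegree_monomial_le _ _).trans ?_
  exact degree_le_matDeg hβ

theorem dotProduct_PAt (x : Fin n → ℝ) (v : Fin m → ℝ) :
    (fun i => C (v i)) ⬝ᵥ (prob.PAt x *ᵥ fun i => C (v i)) =
      prob.applyX fun F => v ⬝ᵥ (evalMat x F *ᵥ v) := by
  ext β
  rw [coeff_applyX _ (by simp [evalMat, mulVec, dotProduct])]
  simp only [dotProduct, mulVec, coeff_sum, coeff_C_mul, evalMat, coeffMat, Matrix.map_apply, PAt]
  refine Finset.sum_congr rfl fun i _ => ?_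
  congr 1
  refine Finset.sum_congr rfl fun j _ => ?_
  rw [mul_comm, coeff_C_mul, coeff_map, mul_comm]

theorem eval_dotProduct_PAt (x : Fin n → ℝ) (v : Fin m → ℝ) (y : Fin ℓ → ℝ) :
    eval y ((fun i => C (v i)) ⬝ᵥ (prob.PAt x *ᵥ fun i => C (v i))) =
      v ⬝ᵥ (evalMat y (prob.PAt x) *ᵥ v) := by
  simp [dotProduct, mulVec, evalMat]

end Problem

/-! ### The compact family of constraints and strong duality -/

namespace Problem

variable {ℓ n s q m : ℕ} (prob : Problem ℓ n s q m)

/-- The coefficients of a combination of the constraints: one for each `θ_i`, and one for each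
monomial in `y` of `P`. -/
abbrev ConstraintSpace : Type := (Fin s → ℝ) × (matSupport prob.P → ℝ)

/-- The polynomial in `y` with the given coefficients. -/
def constraintPoly : prob.ConstraintSpace →ₗ[ℝ] MvPolynomial (Fin ℓ) ℝ :=
  (Fintype.linearCombination ℝ prob.θ).coprod
    (Fintype.linearCombination ℝ fun β : matSupport prob.P => monomial (β : Fin ℓ →₀ ℕ) (1 : ℝ))

theorem constraintPoly_apply (c : Fin s → ℝ)
    (L : Matrix (Fin m) (Fin m) (MvPolynomial (Fin n) ℝ) → ℝ) :
    prob.constraintPoly (c, fun β => L (coeffMat prob.P β)) =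
      ∑ i, c i • prob.θ i + prob.applyX L := by
  simp only [constraintPoly, LinearMap.coprod_apply, Fintype.linearCombination_apply,
    smul_monomial, smul_eq_mul, mul_one, applyX]
  congr 1
  exact Finset.sum_coe_sort (matSupport prob.P) fun β => monomial β (L (coeffMat prob.P β))

/-- The coefficients of the constraint `0 ≤ vᵀ P(y, x) v`. -/
def quadConstraint (p : (Fin n → ℝ) × (Fin m → ℝ)) : prob.ConstraintSpace :=
  (0, fun β => p.2 ⬝ᵥ (evalMat p.1 (coeffMat prob.P β) *ᵥ p.2))

theorem constraintPoly_quadConstraint (x : Fin n → ℝ) (v : Fin m → ℝ) :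
    prob.constraintPoly (prob.quadConstraint (x, v)) =
      (fun i => C (v i)) ⬝ᵥ (prob.PAt x *ᵥ fun i => C (v i)) := by
  rw [dotProduct_PAt]
  simpa [quadConstraint] using prob.constraintPoly_apply 0 fun F => v ⬝ᵥ (evalMat x F *ᵥ v)

theorem constraintPoly_single (i : Fin s) :
    prob.constraintPoly (Pi.single i 1, 0) = prob.θ i := by
  simp [constraintPoly]

theorem continuous_quadConstraint : Continuous prob.quadConstraint := by
  refine continuous_const.prodMk (continuous_pi fun β => ?_)
  simp only [dotProduct, mulVec, evalMat, Matrix.map_apply]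
  have (p : MvPolynomial (Fin n) ℝ) :
      Continuous fun z : (Fin n → ℝ) × (Fin m → ℝ) => eval z.1 p :=
    (MvPolynomial.continuous_eval p).comp continuous_fst
  fun_prop

/-- The constraints `0 ≤ θ_i(y)`, and `0 ≤ vᵀ P(y, x) v` for `x ∈ X` and `v` in the unit sphere. -/
def constraints : Set prob.ConstraintSpace :=
  (Set.range fun i => (Pi.single i 1, 0)) ∪ prob.quadConstraint '' (prob.X ×ˢ Metric.sphere 0 1)

theorem isCompact_constraints (hX : IsCompact prob.X) : IsCompact prob.constraints :=
  (Set.finite_range _).isCompact.union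
    ((hX.prod (isCompact_sphere 0 1)).image prob.continuous_quadConstraint)

theorem forall_mem_constraints {p : MvPolynomial (Fin ℓ) ℝ → Prop}
    (hθ : ∀ i, p (prob.θ i)) (hP : ∀ x ∈ prob.X, ∀ v ∈ Metric.sphere (0 : Fin m → ℝ) 1,
      p ((fun i => C (v i)) ⬝ᵥ (prob.PAt x *ᵥ fun i => C (v i)))) :
    ∀ g ∈ prob.constraints, p (prob.constraintPoly g) := by
  rintro _ (⟨i, rfl⟩ | ⟨⟨x, v⟩, ⟨hx, hv⟩, rfl⟩)
  · rw [constraintPoly_single]; exact hθ i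
  · rw [constraintPoly_quadConstraint]; exact hP x hx v hv

theorem isHermitian_evalMat_PAt (x : Fin n → ℝ) (y : Fin ℓ → ℝ) :
    (evalMat y (prob.PAt x)).IsHermitian := by
  ext i j
  simp [evalMat, PAt, prob.P_symm.apply i j]

theorem mem_feasibleSet_of_constraints {y : Fin ℓ → ℝ}
    (h : ∀ g ∈ prob.constraints, 0 ≤ eval y (prob.constraintPoly g)) : y ∈ prob.feasibleSet := by
  refine ⟨fun i => ?_, fun x hx => ?_⟩
  · simpa [constraintPoly_single] using h _ (Or.inl ⟨i, rfl⟩)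
  · refine Matrix.PosSemidef.of_dotProduct_mulVec_nonneg (prob.isHermitian_evalMat_PAt x y)
      fun v => ?_
    rcases eq_or_ne v 0 with rfl | hv
    · simp
    -- The form is quadratic in `v`, so rescaling `v` to the unit sphere (of the sup norm) only
    -- introduces a positive factor.
    have hv' : ‖v‖ ≠ 0 := norm_ne_zero_iff.2 hv
    have := h _ (Or.inr ⟨(x, ‖v‖⁻¹ • v), ⟨hx, by simp [norm_smul, hv']⟩, rfl⟩)
    rw [constraintPoly_quadConstraint, eval_dotProduct_PAt, mulVec_smul, smul_dotProduct,
      dotProduct_smul, smul_smul, smul_eq_mul] at this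
    have hpos : 0 < ‖v‖⁻¹ * ‖v‖⁻¹ := by positivity
    exact nonneg_of_mul_nonneg_right this hpos

variable {prob}

theorem constraints_nonneg_of_mem_feasibleSet {y : Fin ℓ → ℝ} (hy : y ∈ prob.feasibleSet) :
    ∀ g ∈ prob.constraints, 0 ≤ eval y (prob.constraintPoly g) :=
  prob.forall_mem_constraints (p := fun p => 0 ≤ eval y p) hy.1 fun x hx v _ => by
    rw [eval_dotProduct_PAt]
    exact (hy.2 x hx).dotProduct_mulVec_nonneg v

theorem SOSConvexity.sosConvex_neg (hconv : prob.SOSConvexity) :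
    ∀ g ∈ prob.constraints, SOSConvex (-prob.constraintPoly g) :=
  prob.forall_mem_constraints (p := fun p => SOSConvex (-p)) hconv.θ_sosConvex fun x hx v _ => by
    simpa [neg_mulVec] using hconv.P_psdSOSConvex x hx v

/-- The combinations of this form are a convex set containing `0` and every generator: the
constraint `vᵀ P(y, x) v` corresponds to the single atom `v vᵀ` at `x`. -/
theorem exists_atomicFunctional_of_mem_convexHull {b : prob.ConstraintSpace}
    (hb : b ∈ convexHull ℝ (insert 0 prob.constraints)) :
    0 ≤ b.1 ∧ ∃ w : prob.X →₀ Matrix (Fin m) (Fin m) ℝ, (∀ x, (w x).PosSemidef) ∧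
      b.2 = fun β : matSupport prob.P => atomicFunctional w (coeffMat prob.P β) := by
  classical
  let K : Set prob.ConstraintSpace := {b | 0 ≤ b.1 ∧ ∃ w : prob.X →₀ Matrix (Fin m) (Fin m) ℝ,
    (∀ x, (w x).PosSemidef) ∧ b.2 = fun β : matSupport prob.P => atomicFunctional w (coeffMat prob.P β)}
  refine convexHull_min (t := K) (Set.insert_subset ?_ ?_) ?_ hb
  · exact ⟨le_rfl, 0, fun x => Matrix.PosSemidef.zero, by ext β; simp [atomicFunctional]⟩
  · rintro _ (⟨i, rfl⟩ | ⟨⟨x, v⟩, ⟨hx, -⟩, rfl⟩)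
    · exact ⟨Pi.single_nonneg.2 zero_le_one, 0, fun x => Matrix.PosSemidef.zero,
        by ext β; simp [atomicFunctional]⟩
    · refine ⟨le_rfl, Finsupp.single ⟨x, hx⟩ (vecMulVec v v), fun x' => ?_, ?_⟩
      · rw [Finsupp.single_apply]
        split_ifs
        · simpa using Matrix.posSemidef_vecMulVec_self_star v
        · exact Matrix.PosSemidef.zero
      · ext β
        rw [atomicFunctional, Finsupp.sum_single_index (by simp), trace_vecMulVec_mul]
        rfl
  · rintro b ⟨hb, w, hw, hbw⟩ b' ⟨hb', w', hw', hbw'⟩ r r' hr hr' -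
    refine ⟨add_nonneg (smul_nonneg hr hb) (smul_nonneg hr' hb'), r • w + r' • w',
      fun x => ((hw x).smul hr).add ((hw' x).smul hr'), ?_⟩
    ext β
    simp [hbw, hbw', atomicFunctional_add, atomicFunctional_smul]

theorem fStar_eq {y : Fin ℓ → ℝ} (hy : y ∈ prob.optimizers) : prob.fStar = eval y prob.f :=
  IsLeast.csInf_eq ⟨⟨y, hy.1, rfl⟩, by rintro _ ⟨z, hz, rfl⟩; exact hy.2 z hz⟩

/-- Strong duality: a certificate of optimality with a finitely atomic multiplier and constant
multipliers for the `θ_i`. -/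
theorem exists_certificate (hopt : prob.optimizers.Nonempty) (hconv : prob.SOSConvexity)
    (hslater : prob.Slater) :
    ∃ (c : Fin s → ℝ) (w : prob.X →₀ Matrix (Fin m) (Fin m) ℝ), 0 ≤ c ∧
      (∀ x, (w x).PosSemidef) ∧
      IsSumSq (prob.f - C prob.fStar - prob.applyX (atomicFunctional w) -
        ∑ i, c i • prob.θ i) := by
  obtain ⟨y, hy⟩ := hopt
  obtain ⟨y₀, -, hθ₀, hP₀⟩ := hslater
  obtain ⟨M, hM, b, hb, hle⟩ := exists_lagrange_multiplier
    (f := fun z => eval z prob.f) (c := prob.fStar) (y₀ := y₀)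
    hconv.f_sosConvex.convexOn (MvPolynomial.continuous_eval _)
    (prob.isCompact_constraints hconv.isCompact_X)
    (fun z => (aeval z).toLinearMap ∘ₗ prob.constraintPoly)
    (fun g => by simpa [aeval_eq_eval] using MvPolynomial.continuous_eval (prob.constraintPoly g))
    (fun g hg => by
      simpa [aeval_eq_eval, Pi.neg_def] using (hconv.sosConvex_neg g hg).convexOn.neg)
    (by
      simp only [LinearMap.comp_apply, AlgHom.toLinearMap_apply, aeval_eq_eval]
      refine prob.forall_mem_constraints (p := fun p => 0 < eval y₀ p) hθ₀ fun x hx v hv => ?_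
      rw [eval_dotProduct_PAt]
      exact (hP₀ x hx).dotProduct_mulVec_pos (ne_zero_of_mem_unit_sphere ⟨v, hv⟩))
    (fun z hz => by
      rw [fStar_eq hy]
      exact hy.2 z (prob.mem_feasibleSet_of_constraints fun g hg => by
        simpa [aeval_eq_eval] using hz g hg))
  simp only [LinearMap.comp_apply, AlgHom.toLinearMap_apply, aeval_eq_eval] at hle
  have hby : 0 ≤ eval y (prob.constraintPoly b) := by
    have hK : Convex ℝ {b : prob.ConstraintSpace |
        0 ≤ ((aeval y).toLinearMap ∘ₗ prob.constraintPoly) b} :=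
      (convex_Ici (0 : ℝ)).linear_preimage _
    have := convexHull_min (Set.insert_subset (by simp) fun g hg => by
      simpa [aeval_eq_eval] using constraints_nonneg_of_mem_feasibleSet hy.1 g hg) hK hb
    simpa [aeval_eq_eval] using this
  have hbconv : SOSConvex (-prob.constraintPoly b) := by
    have hK : Convex ℝ {b : prob.ConstraintSpace | SOSConvex (-prob.constraintPoly b)} := by
      intro g hg g' hg' r r' hr hr' _
      have h1 : SOSConvex (-prob.constraintPoly g) := hg
      have h2 : SOSConvex (-prob.constraintPoly g') := hg'
      have := (h1.smul hr).add (h2.smul hr')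
      rw [Set.mem_ofPred_eq, map_add, map_smul, map_smul]
      convert! this using 1
      module
    have h0 : SOSConvex (-prob.constraintPoly 0) := by
      rw [map_zero, neg_zero]
      exact SOSConvex.zero
    exact convexHull_min (t := {b | SOSConvex (-prob.constraintPoly b)})
      (Set.insert_subset h0 hconv.sosConvex_neg) hK hb
  obtain ⟨hc, w, hw, hbw⟩ := exists_atomicFunctional_of_mem_convexHull hb
  have hpoly : prob.constraintPoly b =
      ∑ i, b.1 i • prob.θ i + prob.applyX (atomicFunctional w) := by
    rw [← constraintPoly_apply, ← hbw]
  refine ⟨M • b.1, M • w, smul_nonneg hM hc, fun x => (hw x).smul hM, ?_⟩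
  have hsmul : prob.applyX (atomicFunctional (M • w)) = M • prob.applyX (atomicFunctional w) := by
    simp only [applyX, atomicFunctional_smul, Finset.smul_sum, smul_monomial, smul_eq_mul]
  have e : prob.f - C prob.fStar - prob.applyX (atomicFunctional (M • w)) -
      ∑ i, (M • b.1) i • prob.θ i = prob.f + C (-prob.fStar) + M • -prob.constraintPoly b := by
    rw [hpoly, hsmul, C_neg, smul_neg, smul_add, Finset.smul_sum]
    simp only [Pi.smul_apply, smul_assoc]
    abel
  rw [e]
  have heval (z : Fin ℓ → ℝ) : eval z (prob.f + C (-prob.fStar) + M • -prob.constraintPoly b) =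
      eval z prob.f - M * eval z (prob.constraintPoly b) - prob.fStar := by
    simp [smul_eval]
    ring
  have hnonneg (z : Fin ℓ → ℝ) :
      0 ≤ eval z (prob.f + C (-prob.fStar) + M • -prob.constraintPoly b) := by
    rw [heval]
    linarith [hle z]
  -- Complementary slackness: at the optimizer the Lagrangian equals `-M b(y) ≤ 0`, and it is
  -- nonnegative everywhere, so it vanishes there.
  refine SOSConvex.isSumSq (u := y) ((hconv.f_sosConvex.add (SOSConvex.C _)).add (hbconv.smul hM))
    hnonneg (le_antisymm ?_ (hnonneg y))
  rw [heval, fStar_eq hy]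
  linarith [mul_nonneg hM hby]

end Problem

theorem isSymm_of_posSemidef {ι : Type*} {A : Matrix ι ι ℝ} (hA : A.PosSemidef) : A.IsSymm := by
  rw [Matrix.IsSymm, ← Matrix.conjTranspose_eq_transpose_of_trivial]
  exact hA.isHermitian.eq

/-! ### Finitely atomic matrix-valued measures -/

section AtomicMeasures

open MeasureTheory

variable {n : ℕ} {X : Set (Fin n → ℝ)} {ι : Type*} [Fintype ι]

/-- The matrix-valued measure `∑_x W_x δ_x` of a finitely supported family of matrices. -/
def atomicMeasure (w : X →₀ Matrix ι ι ℝ) : Matrix ι ι (SignedMeasure X) :=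
  Matrix.of fun a b => ∑ i, VectorMeasure.dirac (w.support.equivFin.symm i : X)
    (w (w.support.equivFin.symm i : X) a b)

theorem isFinitelyAtomicPSD_atomicMeasure {w : X →₀ Matrix ι ι ℝ}
    (hw : ∀ x, (w x).PosSemidef) : IsFinitelyAtomicPSD (atomicMeasure w) := by
  classical
  refine ⟨⟨?_, fun A hA v => ?_⟩, _, fun i => w (w.support.equivFin.symm i : X),
    fun i => (w.support.equivFin.symm i : X), fun i => hw _,
    Subtype.val_injective.comp w.support.equivFin.symm.injective, fun a b => rfl⟩
  · ext1 a b
    have (x : X) : w x b a = w x a b := (isSymm_of_posSemidef (hw x)).apply a b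
    simp only [Matrix.transpose_apply, atomicMeasure, Matrix.of_apply, this]
  · have : (Matrix.of fun a b => atomicMeasure w a b A) =
        ∑ i, if (w.support.equivFin.symm i : X) ∈ A then w (w.support.equivFin.symm i : X)
          else 0 := by
      ext1 a b
      simp only [atomicMeasure, Matrix.of_apply, Matrix.sum_apply, FunLike.coe_sum,
        Finset.sum_apply]
      refine Finset.sum_congr rfl fun i _ => ?_
      split_ifs with h
      · rw [VectorMeasure.dirac_apply_of_mem hA h]
      · rw [VectorMeasure.dirac_apply_of_notMem h, Matrix.zero_apply]
    rw [this]
    refine (Matrix.posSemidef_sum _ fun i _ => ?_).dotProduct_mulVec_nonneg v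
    split_ifs
    · exact hw _
    · exact Matrix.PosSemidef.zero

theorem measureFunctional_atomicMeasure {w : X →₀ Matrix ι ι ℝ} (hw : ∀ x, (w x).IsSymm)
    (F : Matrix ι ι (MvPolynomial (Fin n) ℝ)) :
    measureFunctional (atomicMeasure w) F = atomicFunctional w F := by
  have hint (a b : ι) : VectorMeasure.integral (atomicMeasure w a b)
      (fun x : X => eval (x : Fin n → ℝ) (F a b)) (ContinuousLinearMap.lsmul ℝ ℝ) =
      w.sum fun x W => eval (x : Fin n → ℝ) (F a b) * W a b := by
    rw [atomicMeasure, Matrix.of_apply, VectorMeasure.integral_finsetSum_vectorMeasure]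
    · simp only [VectorMeasure.integral_dirac, ContinuousLinearMap.lsmul_apply, smul_eq_mul]
      rw [Finsupp.sum, ← Finset.sum_coe_sort w.support]
      exact w.support.equivFin.symm.sum_comp
        fun x => eval (x : Fin n → ℝ) (F a b) * w (x : X) a b
    · intro i _
      rw [VectorMeasure.Integrable, VectorMeasure.variation_dirac]
      exact (integrable_dirac (by simp)).smul_measure (by simp)
  simp only [measureFunctional, hint]
  rw [atomicFunctional]
  simp only [Finsupp.sum, Matrix.trace, Matrix.diag_apply, Matrix.mul_apply, evalMat,
    Matrix.map_apply]
  rw [Finset.sum_congr rfl fun a _ => Finset.sum_comm, Finset.sum_comm]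
  refine Finset.sum_congr rfl fun x _ => ?_
  rw [Finset.sum_comm]
  exact Finset.sum_congr rfl fun b _ => Finset.sum_congr rfl fun a _ => by
    -- Symmetry of `W_x` reconciles `∑ F_ab W_ab`, from the integrals, with `tr (W F) = ∑ W_ba
    -- F_ab`.
    rw [(hw x).apply b a, mul_comm]

end AtomicMeasures

/-! ### Moment and localizing matrices, truncation -/

section Moments

variable {σ ι κ : Type*} [Fintype ι]

theorem evalMat_eq_sum [Fintype κ] (x : σ → ℝ) (F : Matrix ι κ (MvPolynomial σ ℝ)) :
    evalMat x F = ∑ α ∈ matSupport F, eval x (monomial α 1) • coeffMat F α := by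
  ext i j
  have hsub : (F i j).support ⊆ matSupport F := fun α hα => by
    simp only [matSupport, Finset.mem_biUnion]
    exact ⟨i, Finset.mem_univ i, j, Finset.mem_univ j, hα⟩
  have : F i j = ∑ α ∈ matSupport F, coeff α (F i j) • monomial α (1 : ℝ) := by
    conv_lhs => rw [(F i j).as_sum]
    rw [Finset.sum_subset hsub fun α _ h => by rw [notMem_support_iff.1 h, monomial_zero]]
    simp [smul_monomial]
  rw [evalMat, Matrix.map_apply]
  conv_lhs => rw [this]
  simp only [map_sum, smul_eval, Matrix.sum_apply, Matrix.smul_apply, coeffMat, Matrix.map_apply,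
    smul_eq_mul]
  exact Finset.sum_congr rfl fun α _ => mul_comm _ _

/-- A pullback of `A` conjugated by a diagonal matrix. With `u` the monomial values at a point, this
is the contribution of one atom to a moment or localizing matrix. -/
theorem posSemidef_mul_mul {J : Type*} [Finite J] {A : Matrix κ κ ℝ} (hA : A.PosSemidef)
    (u : J → ℝ) (e : J → κ) : (Matrix.of fun a b => u a * u b * A (e a) (e b)).PosSemidef := by
  classical
  have := Fintype.ofFinite J
  convert! (hA.submatrix e).conjTranspose_mul_mul_same (Matrix.diagonal u) using 1
  ext a b
  simp
  ring

instance [Finite σ] (d : ℕ) : Finite {α : σ →₀ ℕ // α.degree ≤ d} :=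
  (Finsupp.finite_of_degree_le d).to_subtype

variable [Fintype κ]

theorem riesz_congr {S S' : (σ →₀ ℕ) → Matrix ι ι ℝ} {F : Matrix ι ι (MvPolynomial σ ℝ)}
    {d : ℕ} (hF : matDeg F ≤ d) (h : ∀ α : σ →₀ ℕ, α.degree ≤ d → S α = S' α) :
    riesz S F = riesz S' F :=
  Finset.sum_congr rfl fun α hα => by rw [h α ((degree_le_matDeg hα).trans hF)]

omit [Fintype ι] in
theorem localizingMatrix_congr {S S' : (σ →₀ ℕ) → Matrix ι ι ℝ}
    {G : Matrix κ κ (MvPolynomial σ ℝ)} {k : ℕ} (hk : halfCeil (matDeg G) ≤ k)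
    (h : ∀ α : σ →₀ ℕ, α.degree ≤ 2 * k → S α = S' α) :
    localizingMatrix (k - halfCeil (matDeg G)) G S =
      localizingMatrix (k - halfCeil (matDeg G)) G S' := by
  ext a b
  simp only [localizingMatrix, Matrix.of_apply]
  refine congrArg (fun M : Matrix (ι × κ) (ι × κ) ℝ => M a.2 b.2)
    (Finset.sum_congr rfl fun γ hγ => ?_)
  rw [h]
  -- The exponents have degree at most `2 (k - d_G) + deg G ≤ 2k`; `d_G ≤ k` makes the subtraction
  -- exact.
  have h1 := a.1.2
  have h2 := b.1.2
  have h3 := degree_le_matDeg hγ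
  have h4 := le_two_mul_halfCeil (matDeg G)
  simp only [map_add]
  omega

omit [Fintype ι] in
theorem momentMatrix_congr {S S' : (σ →₀ ℕ) → Matrix ι ι ℝ} {k : ℕ}
    (h : ∀ α : σ →₀ ℕ, α.degree ≤ 2 * k → S α = S' α) : momentMatrix k S = momentMatrix k S' := by
  ext a b
  simp only [momentMatrix, Matrix.of_apply]
  rw [h]
  have h1 := a.1.2
  have h2 := b.1.2
  simp only [map_add]
  omega

open Classical in
/-- The part of degree at most `d` of a sequence of matrices. -/
def truncateSeq (d : ℕ) (S : (σ →₀ ℕ) → Matrix ι ι ℝ) : (σ →₀ ℕ) → Matrix ι ι ℝ :=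
  fun α => if α.degree ≤ d then S α else 0

omit [Fintype ι] in
theorem truncateSeq_of_le {d : ℕ} (S : (σ →₀ ℕ) → Matrix ι ι ℝ) {α : σ →₀ ℕ}
    (hα : α.degree ≤ d) : truncateSeq d S α = S α := if_pos hα

theorem truncateSeq_mem_momentCone [DecidableEq ι] {S : (σ →₀ ℕ) → Matrix ι ι ℝ}
    {G : Matrix κ κ (MvPolynomial σ ℝ)} {k : ℕ} (hk : halfCeil (matDeg G) ≤ k)
    (hS : ∀ α, (S α).IsSymm) (hM : (momentMatrix k S).PosSemidef)
    (hL : (localizingMatrix (k - halfCeil (matDeg G)) G S).PosSemidef) :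
    truncateSeq (2 * k) S ∈ momentCone ι k G := by
  refine ⟨fun α => ?_, fun α hα => if_neg hα.not_ge, ?_, ?_⟩
  · unfold truncateSeq
    split_ifs
    · exact hS α
    · exact Matrix.transpose_zero
  · rwa [momentMatrix_congr fun α hα => truncateSeq_of_le S hα]
  · rwa [localizingMatrix_congr hk fun α hα => truncateSeq_of_le S hα]

/-- The matrices of order `k` are principal submatrices of those of order `k'`. -/
theorem truncateSeq_mem_momentCone_of_le [DecidableEq ι] {S : (σ →₀ ℕ) → Matrix ι ι ℝ}
    {G : Matrix κ κ (MvPolynomial σ ℝ)} {k k' : ℕ} (hk : halfCeil (matDeg G) ≤ k) (hkk : k ≤ k')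
    (hS : S ∈ momentCone ι k' G) : truncateSeq (2 * k) S ∈ momentCone ι k G := by
  let incl {d d' : ℕ} (hd : d ≤ d') (α : {α : σ →₀ ℕ // α.degree ≤ d}) :
      {α : σ →₀ ℕ // α.degree ≤ d'} := ⟨α.1, α.2.trans hd⟩
  refine truncateSeq_mem_momentCone hk hS.1 ?_ ?_
  · have := hS.2.2.1.submatrix fun a : {α : σ →₀ ℕ // α.degree ≤ k} × ι => (incl hkk a.1, a.2)
    exact this
  · have := hS.2.2.2.submatrix
      fun a : {α : σ →₀ ℕ // α.degree ≤ k - halfCeil (matDeg G)} × (ι × κ) =>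
        (incl (Nat.sub_le_sub_right hkk _) a.1, a.2)
    exact this

end Moments

/-! ### Moments of atomic measures -/

section AtomicMoments

variable {n : ℕ} {X : Set (Fin n → ℝ)} {ι κ : Type*} [Fintype ι] [Fintype κ]

/-- The moments `∑_x x ^ α W_x` of a finitely supported family of matrices. -/
def atomicMoments (w : X →₀ Matrix ι ι ℝ) (α : Fin n →₀ ℕ) : Matrix ι ι ℝ :=
  w.sum fun x W => eval (x : Fin n → ℝ) (monomial α 1) • W

theorem riesz_atomicMoments (w : X →₀ Matrix ι ι ℝ) (F : Matrix ι ι (MvPolynomial (Fin n) ℝ)) :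
    riesz (atomicMoments w) F = atomicFunctional w F := by
  simp only [riesz, atomicMoments, atomicFunctional, Finsupp.sum, evalMat_eq_sum, Finset.mul_sum,
    Matrix.trace_sum]
  rw [Finset.sum_comm]
  refine Finset.sum_congr rfl fun x _ => Finset.sum_congr rfl fun α _ => ?_
  rw [Matrix.mul_smul, Matrix.mul_smul, Matrix.trace_smul, Matrix.trace_smul, Matrix.trace_mul_comm]

theorem eval_monomial_add {σ : Type*} (x : σ → ℝ) (α β : σ →₀ ℕ) :
    eval x (monomial (α + β) 1) = eval x (monomial α 1) * eval x (monomial β 1) := by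
  rw [← map_mul, monomial_mul, one_mul]

theorem posSemidef_momentMatrix_atomicMoments {w : X →₀ Matrix ι ι ℝ}
    (hw : ∀ x, (w x).PosSemidef) (d : ℕ) : (momentMatrix d (atomicMoments w)).PosSemidef := by
  have : momentMatrix d (atomicMoments w) = ∑ x ∈ w.support, Matrix.of fun a b =>
      eval (x : Fin n → ℝ) (monomial a.1.1 1) * eval (x : Fin n → ℝ) (monomial b.1.1 1) *
        w x a.2 b.2 := by
    ext a b
    simp only [momentMatrix, atomicMoments, Finsupp.sum, Matrix.of_apply, Matrix.sum_apply,
      Matrix.smul_apply, eval_monomial_add, smul_eq_mul]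
  rw [this]
  exact Matrix.posSemidef_sum _ fun x _ => posSemidef_mul_mul (hw x) _ _

/-- Each atom contributes `x^α x^β (W_x ⊗ G(x))`, and the Kronecker product of positive semidefinite
matrices is positive semidefinite. -/
theorem posSemidef_localizingMatrix_atomicMoments {w : X →₀ Matrix ι ι ℝ}
    (hw : ∀ x, (w x).PosSemidef) {G : Matrix κ κ (MvPolynomial (Fin n) ℝ)}
    (hG : ∀ x ∈ X, (evalMat x G).PosSemidef) (d : ℕ) :
    (localizingMatrix d G (atomicMoments w)).PosSemidef := by
  have : localizingMatrix d G (atomicMoments w) = ∑ x ∈ w.support, Matrix.of fun a b =>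
      eval (x : Fin n → ℝ) (monomial a.1.1 1) * eval (x : Fin n → ℝ) (monomial b.1.1 1) *
        (w x ⊗ₖ evalMat (x : Fin n → ℝ) G) a.2 b.2 := by
    ext a b
    simp only [localizingMatrix, atomicMoments, Finsupp.sum, Matrix.of_apply, Matrix.sum_apply,
      Matrix.smul_apply, eval_monomial_add, smul_eq_mul, Matrix.kroneckerMap_apply,
      evalMat_eq_sum, Finset.sum_mul, Finset.mul_sum]
    rw [Finset.sum_comm]
    exact Finset.sum_congr rfl fun x _ => Finset.sum_congr rfl fun γ _ => by ring
  rw [this]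
  exact Matrix.posSemidef_sum _ fun x _ =>
    posSemidef_mul_mul ((hw x).kronecker (hG x x.2)) _ _

omit [Fintype ι] in
theorem isSymm_atomicMoments {w : X →₀ Matrix ι ι ℝ} (hw : ∀ x, (w x).IsSymm) (α : Fin n →₀ ℕ) :
    (atomicMoments w α).IsSymm := by
  rw [Matrix.IsSymm, atomicMoments, Finsupp.sum, Matrix.transpose_sum]
  exact Finset.sum_congr rfl fun x _ => by rw [Matrix.transpose_smul, (hw x).eq]

end AtomicMoments

/-! ### Positivity of scalar pseudo-moment functionals -/

section ScalarMoments

variable {σ : Type*}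

/-- The Riesz functional of a scalar sequence as a linear map. -/
def scalarRieszLinear (t : (σ →₀ ℕ) → ℝ) : MvPolynomial σ ℝ →ₗ[ℝ] ℝ :=
  (basisMonomials σ ℝ).constr ℝ t

theorem scalarRieszLinear_monomial (t : (σ →₀ ℕ) → ℝ) (α : σ →₀ ℕ) (c : ℝ) :
    scalarRieszLinear t (monomial α c) = c * t α := by
  have : monomial α c = c • basisMonomials σ ℝ α := by simp [smul_monomial]
  rw [this, map_smul, scalarRieszLinear, Module.Basis.constr_basis, smul_eq_mul]

theorem scalarRieszLinear_apply (t : (σ →₀ ℕ) → ℝ) (p : MvPolynomial σ ℝ) :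
    scalarRieszLinear t p = scalarRiesz t p := by
  conv_lhs => rw [p.as_sum]
  simp only [map_sum, scalarRieszLinear_monomial, scalarRiesz]

variable {s k : ℕ} {θ : Fin s → MvPolynomial σ ℝ} {t : (σ →₀ ℕ) → ℝ}

theorem scalarRieszLinear_mul_self_nonneg (ht : t ∈ scalarMomentCone k θ) {p : MvPolynomial σ ℝ}
    (hp : p.totalDegree ≤ k) : 0 ≤ scalarRieszLinear t (p * p) := by
  have h := (ht.2.2.1.submatrix fun α : p.support =>
    ((⟨α.1, (le_totalDegree α.2).trans hp⟩, 0) :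
      {α : σ →₀ ℕ // α.degree ≤ k} × Fin 1)).dotProduct_mulVec_nonneg fun α => coeff α.1 p
  convert! h using 1
  conv_lhs => rw [p.as_sum]
  simp only [Finset.sum_mul_sum, monomial_mul, map_sum, scalarRieszLinear_monomial]
  simp only [dotProduct, mulVec, momentMatrix, Matrix.submatrix_apply, Matrix.of_apply,
    Finset.mul_sum]
  rw [← Finset.sum_coe_sort p.support]
  refine Finset.sum_congr rfl fun α _ => ?_
  rw [← Finset.sum_coe_sort p.support]
  refine Finset.sum_congr rfl fun β _ => ?_
  simp
  ring

theorem scalarRieszLinear_constraint_nonneg (ht : t ∈ scalarMomentCone k θ) (i : Fin s) :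
    0 ≤ scalarRieszLinear t (θ i) := by
  -- The diagonal entry at the exponent `0` is `H_t(θ_i)`; this suffices because the multipliers of
  -- the `θ_i` are constants.
  have h := ht.2.2.2.diag_nonneg (i := (⟨0, by simp⟩, (0, i)))
  simp only [localizingMatrix, Matrix.of_apply, Matrix.sum_apply, Matrix.kroneckerMap_apply,
    zero_add, coeffMat, Matrix.map_apply, Matrix.diagonal_apply_eq] at h
  convert! h using 1
  rw [scalarRieszLinear_apply, scalarRiesz]
  have hsub : (θ i).support ⊆ matSupport (Matrix.diagonal θ) := fun α hα => by
    simp only [matSupport, Finset.mem_biUnion]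
    exact ⟨i, Finset.mem_univ i, i, Finset.mem_univ i, by simpa using hα⟩
  rw [Finset.sum_subset hsub fun α _ h => by rw [notMem_support_iff.1 h, zero_mul]]
  exact Finset.sum_congr rfl fun α _ => mul_comm _ _

theorem scalarRieszLinear_nonneg_of_isSumSq [Finite σ] (ht : t ∈ scalarMomentCone k θ)
    {p : MvPolynomial σ ℝ} (hp : IsSumSq p) (hpk : p.totalDegree ≤ 2 * k) :
    0 ≤ scalarRieszLinear t p := by
  obtain ⟨l, q, rfl⟩ := exists_eq_sum_mul_self hp
  rw [map_sum]
  exact Finset.sum_nonneg fun i _ =>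
    scalarRieszLinear_mul_self_nonneg ht (totalDegree_le_of_sum_mul_self hpk i)

end ScalarMoments

/-! ### Quadratic modules are positive on `X` -/

section QuadraticModule

variable {σ ι κ : Type*} [Fintype ι] [DecidableEq ι] [Fintype κ]

theorem quadModule_mono {G : Matrix κ κ (MvPolynomial σ ℝ)} {k k' : ℕ} (h : k ≤ k') :
    quadModule ι k G ⊆ quadModule ι k' G := by
  rintro F ⟨S₀, S₁, h₀, h₁, hd₀, hd₁, rfl⟩
  exact ⟨S₀, S₁, h₀, h₁, by omega, by omega, rfl⟩

theorem posSemidef_evalMat_of_mem_quadModule {G : Matrix κ κ (MvPolynomial σ ℝ)} {k : ℕ}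
    {F : Matrix ι ι (MvPolynomial σ ℝ)} (hF : F ∈ quadModule ι k G) {x : σ → ℝ}
    (hx : (evalMat x G).PosSemidef) : (evalMat x F).PosSemidef := by
  obtain ⟨S₀, S₁, ⟨l₀, T₀, rfl⟩, ⟨l, T, rfl⟩, -, -, rfl⟩ := hF
  -- Each row of `T`, reshaped into a `q × m` matrix `T_r`, contributes the congruence `T_rᵀ Gᵀ
  -- T_r`.
  have e : evalMat x (T₀ᵀ * T₀ + blockPairing (Tᵀ * T) G) =
      (evalMat x T₀)ᴴ * evalMat x T₀ + ∑ r, (Matrix.of fun a i => eval x (T r (i, a)))ᴴ *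
        (evalMat x G)ᵀ * Matrix.of fun a i => eval x (T r (i, a)) := by
    ext i j
    simp only [evalMat, Matrix.map_apply, Matrix.add_apply, map_add, Matrix.mul_apply,
      Matrix.transpose_apply, map_sum, map_mul, Matrix.conjTranspose_apply, star_trivial,
      Matrix.sum_apply, Matrix.of_apply, blockPairing_apply, Finset.sum_mul]
    congr 1
    rw [Finset.sum_congr rfl fun a _ => Finset.sum_comm, Finset.sum_comm]
    refine Finset.sum_congr rfl fun r _ => ?_
    rw [Finset.sum_comm]
    exact Finset.sum_congr rfl fun b _ => Finset.sum_congr rfl fun a _ => by ring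
  rw [e]
  exact (Matrix.posSemidef_conjTranspose_mul_self _).add (Matrix.posSemidef_sum _ fun r _ =>
    hx.transpose.conjTranspose_mul_mul_same _)

end QuadraticModule

/-! ### Monotonicity and lower bounds for both hierarchies -/

namespace Problem

variable {ℓ n s q m : ℕ} {prob : Problem ℓ n s q m}

theorem halfCeil_matDeg_le {k : ℕ} (hk : halfCeil prob.kx ≤ k) :
    halfCeil (matDeg prob.G) ≤ k := by
  have : matDeg prob.G ≤ prob.kx := le_max_right _ _
  unfold halfCeil at *
  omega

theorem matDeg_coeffMat_le {k : ℕ} (hk : halfCeil prob.kx ≤ k) {β : Fin ℓ →₀ ℕ}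
    (hβ : β ∈ matSupport prob.P) : matDeg (coeffMat prob.P β) ≤ 2 * k := by
  have h1 : matDeg (coeffMat prob.P β) ≤ prob.kx :=
    (Finset.le_sup (f := fun β => matDeg (coeffMat prob.P β)) hβ).trans (le_max_left _ _)
  have h2 := le_two_mul_halfCeil prob.kx
  omega

theorem applyX_congr {L L' : Matrix (Fin m) (Fin m) (MvPolynomial (Fin n) ℝ) → ℝ}
    (h : ∀ β ∈ matSupport prob.P, L (coeffMat prob.P β) = L' (coeffMat prob.P β)) :
    prob.applyX L = prob.applyX L' :=
  Finset.sum_congr rfl fun β hβ => by rw [h β hβ]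

theorem applyX_riesz_truncateSeq {k : ℕ} (hk : halfCeil prob.kx ≤ k)
    (S : (Fin n →₀ ℕ) → Matrix (Fin m) (Fin m) ℝ) :
    prob.applyX (riesz (truncateSeq (2 * k) S)) = prob.applyX (riesz S) :=
  applyX_congr fun _ hβ => riesz_congr (matDeg_coeffMat_le hk hβ) fun _ hα =>
    truncateSeq_of_le S hα

theorem antitoneOn_fPrimal : AntitoneOn prob.fPrimal (Set.Ici (halfCeil prob.kx)) := by
  intro k hk k' _ hkk
  refine iSup_le fun ρ => iSup₂_le fun S hS => ?_
  refine le_iSup_of_le ρ (le_iSup₂_of_le (truncateSeq (2 * k) S) ⟨?_, ?_⟩ le_rfl)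
  · exact truncateSeq_mem_momentCone_of_le (halfCeil_matDeg_le hk) hkk hS.1
  · rw [applyX_riesz_truncateSeq hk]
    exact hS.2

theorem antitone_fDual : Antitone prob.fDual := by
  intro k k' hkk
  refine le_iInf₂ fun t ht => iInf₂_le_of_le t ⟨ht.1, ht.2.1, ?_⟩ le_rfl
  exact quadModule_mono hkk ht.2.2

variable {c : Fin s → ℝ} {w : prob.X →₀ Matrix (Fin m) (Fin m) ℝ}

theorem totalDegree_θ_le (i : Fin s) : (prob.θ i).totalDegree ≤ prob.ky :=
  (Finset.le_sup (f := fun i => (prob.θ i).totalDegree) (Finset.mem_univ i)).trans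
    ((le_max_left _ _).trans (le_max_right _ _))

theorem totalDegree_sub_applyX_le (ρ : ℝ)
    (L : Matrix (Fin m) (Fin m) (MvPolynomial (Fin n) ℝ) → ℝ) :
    (prob.f - C ρ - prob.applyX L - ∑ i, c i • prob.θ i).totalDegree ≤
      2 * halfCeil prob.ky := by
  refine le_trans ?_ (le_two_mul_halfCeil _)
  have h1 : prob.f.totalDegree ≤ prob.ky := le_max_left _ _
  have h2 : (prob.applyX L).totalDegree ≤ prob.ky :=
    (prob.totalDegree_applyX_le L).trans ((le_max_right _ _).trans (le_max_right _ _))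
  have h3 : (∑ i, c i • prob.θ i).totalDegree ≤ prob.ky :=
    totalDegree_finsetSum_le fun i _ => (totalDegree_smul_le _ _).trans (totalDegree_θ_le i)
  refine (totalDegree_sub _ _).trans (max_le ((totalDegree_sub _ _).trans (max_le
    ((totalDegree_sub _ _).trans (max_le h1 (by simp))) h2)) h3)

theorem mem_scalarQuadModule_of_certificate (hc : 0 ≤ c)
    (h : IsSumSq (prob.f - C prob.fStar - prob.applyX (atomicFunctional w) -
      ∑ i, c i • prob.θ i)) :
    prob.f - C prob.fStar - prob.applyX (atomicFunctional w) ∈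
      scalarQuadModule (halfCeil prob.ky) prob.θ := by
  have := mem_scalarQuadModule h hc (totalDegree_sub_applyX_le _ _)
    fun i => (totalDegree_θ_le i).trans (le_two_mul_halfCeil _)
  rwa [sub_add_cancel] at this

theorem fStar_le_fPrimal (hw : ∀ x, (w x).PosSemidef)
    (h : prob.f - C prob.fStar - prob.applyX (atomicFunctional w) ∈
      scalarQuadModule (halfCeil prob.ky) prob.θ) {k : ℕ} (hk : halfCeil prob.kx ≤ k) :
    (prob.fStar : EReal) ≤ prob.fPrimal k := by
  refine le_iSup_of_le prob.fStar
    (le_iSup₂_of_le (truncateSeq (2 * k) (atomicMoments w)) ⟨?_, ?_⟩ le_rfl)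
  · exact truncateSeq_mem_momentCone (halfCeil_matDeg_le hk)
      (isSymm_atomicMoments fun x => isSymm_of_posSemidef (hw x))
      (posSemidef_momentMatrix_atomicMoments hw _)
      (posSemidef_localizingMatrix_atomicMoments hw (fun x hx => hx) _)
  · rw [applyX_riesz_truncateSeq hk, applyX_congr fun β _ => riesz_atomicMoments w _]
    exact h

/-- Interchange of the functionals in `y` and in `x`; it lets `H_t(P) ∈ Q_k^m(G)` be tested against
the atoms. -/
theorem scalarRieszLinear_applyX_atomicFunctional (t : (Fin ℓ →₀ ℕ) → ℝ)
    (w : prob.X →₀ Matrix (Fin m) (Fin m) ℝ) :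
    scalarRieszLinear t (prob.applyX (atomicFunctional w)) =
      atomicFunctional w (prob.applyY t) := by
  have he (x : Fin n → ℝ) : evalMat x (prob.applyY t) =
      ∑ β ∈ matSupport prob.P, t β • evalMat x (coeffMat prob.P β) := by
    ext i j
    simp [evalMat, applyY, Matrix.sum_apply, smul_eval]
  simp only [applyX, map_sum, scalarRieszLinear_monomial, atomicFunctional, he, Finset.mul_sum,
    Matrix.trace_sum, Finsupp.sum]
  rw [Finset.sum_comm]
  refine Finset.sum_congr rfl fun x _ => Finset.sum_congr rfl fun β _ => ?_
  rw [Matrix.mul_smul, Matrix.trace_smul, smul_eq_mul, mul_comm]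

/-- Weak duality: `H_t` is nonnegative on the SOS part and on each `θ_i`, and also on the multiplier
term, since `H_t(P)` is positive semidefinite at every atom. The certificate and `H_t(1) = 1` then
give `H_t(f) ≥ f⋆`. -/
theorem fStar_le_fDual (hc : 0 ≤ c) (hw : ∀ x, (w x).PosSemidef)
    (h : IsSumSq (prob.f - C prob.fStar - prob.applyX (atomicFunctional w) -
      ∑ i, c i • prob.θ i)) (k : ℕ) : (prob.fStar : EReal) ≤ prob.fDual k := by
  refine le_iInf₂ fun t ⟨ht, ht1, htP⟩ => EReal.coe_le_coe_iff.2 ?_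
  have h1 := scalarRieszLinear_nonneg_of_isSumSq ht h (totalDegree_sub_applyX_le _ _)
  have h2 : 0 ≤ scalarRieszLinear t (prob.applyX (atomicFunctional w)) := by
    rw [scalarRieszLinear_applyX_atomicFunctional]
    exact Finset.sum_nonneg fun x _ =>
      trace_mul_nonneg (hw x) (posSemidef_evalMat_of_mem_quadModule htP x.2)
  have h3 : 0 ≤ scalarRieszLinear t (∑ i, c i • prob.θ i) := by
    rw [map_sum]
    refine Finset.sum_nonneg fun i _ => ?_
    rw [map_smul]
    exact mul_nonneg (hc i) (scalarRieszLinear_constraint_nonneg ht i)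
  have h4 : scalarRieszLinear t (C prob.fStar) = prob.fStar := by
    rw [← mul_one (C prob.fStar), ← smul_eq_C_mul, map_smul, scalarRieszLinear_apply, ht1,
      smul_eq_mul, mul_one]
  rw [map_sub, map_sub, map_sub, h4, scalarRieszLinear_apply t prob.f] at h1
  linarith

end Problem

end RobustPMI

end

/-! ### The proposition -/

theorem mainTheorem5 {ℓ n s q m : ℕ} (prob : RobustPMI.Problem ℓ n s q m)
    (hopt : prob.optimizers.Nonempty) (hconv : prob.SOSConvexity) (hslater : prob.Slater) :
    AntitoneOn prob.fPrimal (Set.Ici (RobustPMI.halfCeil prob.kx)) ∧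
    AntitoneOn prob.fDual (Set.Ici (RobustPMI.halfCeil prob.kx)) ∧
    (∀ k : ℕ, RobustPMI.halfCeil prob.kx ≤ k →
      (prob.fStar : EReal) ≤ prob.fPrimal k ∧ (prob.fStar : EReal) ≤ prob.fDual k) ∧
    ∃ Φ : Matrix (Fin m) (Fin m) (MeasureTheory.SignedMeasure prob.X),
      RobustPMI.IsFinitelyAtomicPSD Φ ∧
      prob.f - MvPolynomial.C prob.fStar - prob.applyX (RobustPMI.measureFunctional Φ) ∈
        RobustPMI.scalarQuadModule (RobustPMI.halfCeil prob.ky) prob.θ := by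
  obtain ⟨c, w, hc, hw, h⟩ := RobustPMI.Problem.exists_certificate hopt hconv hslater
  have hmem := RobustPMI.Problem.mem_scalarQuadModule_of_certificate hc h
  refine ⟨RobustPMI.Problem.antitoneOn_fPrimal, RobustPMI.Problem.antitone_fDual.antitoneOn _,
    fun k hk => ⟨RobustPMI.Problem.fStar_le_fPrimal hw hmem hk,
      RobustPMI.Problem.fStar_le_fDual hc hw h k⟩,
    RobustPMI.atomicMeasure w, RobustPMI.isFinitelyAtomicPSD_atomicMeasure hw, ?_⟩
  rwa [RobustPMI.Problem.applyX_congr fun β _ => RobustPMI.measureFunctional_atomicMeasure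
    (fun x => RobustPMI.isSymm_of_posSemidef (hw x)) _]
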